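/- Let $d\ge 1$, let $\Omega\subset\mathbb R^d$ be a bounded open set, and let $\mathcal T_h=\{K_1,\dots,K_N\}$ be a partition of $\Omega$ into pairwise disjoint nonempty open bounded convex polytopes ($K_k\subset\Omega\subset\bigcup_l\overline{K_l}$). No conformity or shape-regularity is required. Let $\mathcal E_h^I$ be the set of interior faces $e=\partial K\cap\partial K'\cap\Omega$ of dimension $d-1$ (where $K=K_k$, $K'=K_{k'}$, $k<k'$), with unit normal $n_e$ outward from $K$, and let $\mathcal E_h^B$ be the set of boundary faces (the parts of facets of cells $K$ that lie on $\partial\Omega$), with $n_e$ outward from $K$. For $r\ge 0$ let $V_r^h=\prod_{K}\mathbb P_r(K)$ (polynomials of total degree at most $r$ on each cell), let $\mathcal V_h$ be the set of $v$ with $v|_K\in W^{1,1}(K)$ such that $v|_K$ extends continuously to $\overline K$ for every $K\in\mathcal T_h$, and put $(v,w)_{\mathcal T_h}=\sum_K\int_K vw\,dx$, $\|w\|_{L^2(\mathcal T_h)}^2=\sum_K\|w\|_{L^2(K)}^2$, $\langle v,w\rangle_{\mathcal S}=\sum_{e\in\mathcal S}\int_e vw\,ds$. On an interior face put $[v]=v|_K-v|_{K'}$;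 let $\mathcal Q_i^-(v)$ be the trace from $K$ if $n_e^{(i)}<0$ and the trace from $K'$ if $n_e^{(i)}\ge 0$, and let $\mathcal Q_i^+(v)$ be the trace from the other cell. On a boundary face put $[v]=\mathcal Q_i^\pm(v)=v$ (the trace from the adjacent cell). Let $i\in\{1,\dots,d\}$ and let $\gamma_i^-,\gamma_i^+$ be arbitrary real functions that are constant on each interior face. For $v\in\mathcal V_h$ the discrete derivatives $\partial^\pm_{h,x_i}v\in V_r^h$ are defined by $$(\partial^\pm_{h,x_i}v,\varphi_h)_{\mathcal T_h}=\langle \mathcal Q_i^\pm(v)\,n^{(i)},[\varphi_h]\rangle_{\mathcal E_h^I\cup\mathcal E_h^B}-(v,\partial_{x_i}\varphi_h)_{\mathcal T_h}+\langle\gamma_i^\pm[v],[\varphi_h]\rangle_{\mathcal E_h^I}\qquad\forall\varphi_h\in V_r^h,$$ and $\partial_{h,x_i}v=\tfrac12(\partial^-_{h,x_i}v+\partial^+_{h,x_i}v)$. **Theorem.** Let $v\in\mathcal V_h\cap H^1(\Omega)$. Then $\partial^\pm_{h,x_i}v$ are well defined (each identity has exactly one solution in $V_r^h$), and for $*\in\{+,-,\text{empty}\}$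 $$\|\partial_{x_i}v-\partial^*_{h,x_i}v\|_{L^2(\mathcal T_h)}\le\|\partial_{x_i}v-\partial_{x_i}\psi_h\|_{L^2(\mathcal T_h)}\qquad\forall\psi_h\in V_{r+1}^h,$$ $$\|\partial_{x_i}v-\partial^*_{h,x_i}v\|_{L^2(K)}\le\|\partial_{x_i}v-\partial_{x_i}\psi_h\|_{L^2(K)}\qquad\forall\psi_h\in\mathbb P_{r+1},\ \forall K\in\mathcal T_h,$$ where $\partial_{x_i}v$ is the weak derivative and $\partial_{x_i}\psi_h$ is taken cellwise. -/

import Mathlib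

open MeasureTheory Set Filter Topology
open scoped ENNReal ContDiff

namespace DGCalculus

/-! ### Sobolev spaces through weak derivatives -/

/-- `g` is the weak partial derivative `∂v/∂x_i` on the open set `U`. -/
def IsWeakPartial {d : ℕ} (U : Set (EuclideanSpace ℝ (Fin d))) (i : Fin d)
    (v g : EuclideanSpace ℝ (Fin d) → ℝ) : Prop :=
  LocallyIntegrableOn v U ∧ LocallyIntegrableOn g U ∧
    ∀ φ : EuclideanSpace ℝ (Fin d) → ℝ, ContDiff ℝ ∞ φ → HasCompactSupport φ → tsupport φ ⊆ U →
      ∫ x in U, v x * fderiv ℝ φ x (EuclideanSpace.single i 1) = - ∫ x in U, g x * φ x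

/-- `v ∈ W^{1,p}(U)`. -/
def MemW1 {d : ℕ} (U : Set (EuclideanSpace ℝ (Fin d))) (p : ℝ≥0∞)
    (v : EuclideanSpace ℝ (Fin d) → ℝ) : Prop :=
  MemLp v p (volume.restrict U) ∧
    ∀ i : Fin d, ∃ g : EuclideanSpace ℝ (Fin d) → ℝ,
      IsWeakPartial U i v g ∧ MemLp g p (volume.restrict U)

/-! ### Polytopal meshes -/

/-- An open, nonempty, bounded convex polytope in `ℝ^d`, given as the intersection of finitely many
pairwise distinct open half-spaces `{x | ⟪n_j, x⟫ < c_j}` with unit outward normals `n_j`. -/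
structure Polytope (d : ℕ) where
  numFacets : ℕ
  normal : Fin numFacets → EuclideanSpace ℝ (Fin d)
  offset : Fin numFacets → ℝ
  norm_normal : ∀ j, ‖normal j‖ = 1
  distinct : Function.Injective fun j => (normal j, offset j)
  nonempty : {x : EuclideanSpace ℝ (Fin d) | ∀ j, inner ℝ (normal j) x < offset j}.Nonempty
  bounded : Bornology.IsBounded
    {x : EuclideanSpace ℝ (Fin d) | ∀ j, inner ℝ (normal j) x < offset j}

namespace Polytope

/-- The open cell `K`. -/
def carrier {d : ℕ} (K : Polytope d) : Set (EuclideanSpace ℝ (Fin d)) :=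
  {x | ∀ j, inner ℝ (K.normal j) x < K.offset j}

/-- The closed facet of `∂K` with outward unit normal `K.normal j` (a set of dimension less than
`d - 1`, possibly empty, if the `j`-th inequality is redundant). -/
def facet {d : ℕ} (K : Polytope d) (j : Fin K.numFacets) : Set (EuclideanSpace ℝ (Fin d)) :=
  {x | x ∈ closure K.carrier ∧ inner ℝ (K.normal j) x = K.offset j}

/-- The one-sided trace `lim_{y → x, y ∈ K} v(y)`. -/
noncomputable def trace {d : ℕ} (K : Polytope d) (v : EuclideanSpace ℝ (Fin d) → ℝ) :
    EuclideanSpace ℝ (Fin d) → ℝ :=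
  extendFrom K.carrier v

end Polytope

/-- A partition of `Ω` into `N` labelled convex polytopes; the label of a cell is its index in
`Fin N`. Hanging nodes are allowed. -/
structure Mesh (d : ℕ) (Ω : Set (EuclideanSpace ℝ (Fin d))) (N : ℕ) where
  cell : Fin N → Polytope d
  cell_subset : ∀ k, (cell k).carrier ⊆ Ω
  disjoint : Pairwise fun k k' => Disjoint (cell k).carrier (cell k').carrier
  cover : Ω ⊆ ⋃ k, closure (cell k).carrier

/-- `V_r^h = ∏_K ℙ_r(K)`. -/
abbrev DGSpace (d N r : ℕ) : Type :=
  Fin N → MvPolynomial.restrictTotalDegree (Fin d) ℝ r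

/-- The value of a polynomial in `d` variables at a point of `ℝ^d`. -/
noncomputable def polyEval {d : ℕ} (p : MvPolynomial (Fin d) ℝ) (x : EuclideanSpace ℝ (Fin d)) :
    ℝ :=
  MvPolynomial.eval (fun j => x j) p

namespace Mesh

variable {d N : ℕ} {Ω : Set (EuclideanSpace ℝ (Fin d))}

/-- `v ∈ C^0(𝒯_h)`: on each cell, `v` agrees with a continuous function on the closed cell. -/
def MemBrokenC0 (T : Mesh d Ω N) (v : EuclideanSpace ℝ (Fin d) → ℝ) : Prop :=
  ∀ k, ∃ f : EuclideanSpace ℝ (Fin d) → ℝ,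
    ContinuousOn f (closure (T.cell k).carrier) ∧ EqOn v f (T.cell k).carrier

/-- `v ∈ 𝒱_h = W^{1,1}(𝒯_h) ∩ C^0(𝒯_h)`. -/
def MemV (T : Mesh d Ω N) (v : EuclideanSpace ℝ (Fin d) → ℝ) : Prop :=
  (∀ k, MemW1 (T.cell k).carrier 1 v) ∧ T.MemBrokenC0 v

/-- The part, on the `j`-th facet of the cell `k`, of the interior face shared by the cells `k` and
`k'`. For `k < k'` its normal `n_e` is the outward normal of the cell `k`. -/
def interiorFace (T : Mesh d Ω N) (k : Fin N) (j : Fin (T.cell k).numFacets) (k' : Fin N) :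
    Set (EuclideanSpace ℝ (Fin d)) :=
  (T.cell k).facet j ∩ closure (T.cell k').carrier ∩ Ω

/-- The part on `∂Ω` of the `j`-th facet of the cell `k`. -/
def boundaryFace (T : Mesh d Ω N) (k : Fin N) (j : Fin (T.cell k).numFacets) :
    Set (EuclideanSpace ℝ (Fin d)) :=
  (T.cell k).facet j ∩ frontier Ω

/-- The two one-sided choices `-` and `+`. -/
inductive Side
  | minus
  | plus

/-- The trace `𝒬_i^±(v)` on the interior face between the cells `k < k'` with normal component
`ν = n_e^{(i)}`. -/
noncomputable def traceQ (T : Mesh d Ω N) (s : Side) (v : EuclideanSpace ℝ (Fin d) → ℝ)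
    (k k' : Fin N) (ν : ℝ) (x : EuclideanSpace ℝ (Fin d)) : ℝ :=
  match s with
  | Side.minus => if ν < 0 then (T.cell k).trace v x else (T.cell k').trace v x
  | Side.plus => if ν < 0 then (T.cell k').trace v x else (T.cell k).trace v x

/-- The jump `[v] = v|_K - v|_{K'}` on the interior face between `K = cell k`, `K' = cell k'`,
`k < k'`. -/
noncomputable def jump (T : Mesh d Ω N) (v : EuclideanSpace ℝ (Fin d) → ℝ)
    (k k' : Fin N) (x : EuclideanSpace ℝ (Fin d)) : ℝ :=
  (T.cell k).trace v x - (T.cell k').trace v x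

/-- The right-hand side of the identity that defines `∂_{h,x_i}^± v`, for a test function `φ`:
`⟨𝒬_i^±(v) n^{(i)}, [φ]⟩_{ℰ_h} - (v, ∂_{x_i} φ)_{𝒯_h} + ⟨γ_i^± [v], [φ]⟩_{ℰ_h^I}`.
`γ k k'` is the constant value of `γ_i^±` on the interior face between the cells `k < k'`. Surface
integrals are with respect to the `(d-1)`-dimensional Hausdorff measure, normalized as surface
measure. -/
noncomputable def derivFunctional (T : Mesh d Ω N) {r : ℕ} (i : Fin d) (s : Side)
    (γ : Fin N → Fin N → ℝ) (v : EuclideanSpace ℝ (Fin d) → ℝ) (φ : DGSpace d N r) : ℝ :=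
  (∑ k, ∑ k' ∈ Finset.Ioi k, ∑ j, ∫ x in T.interiorFace k j k',
      T.traceQ s v k k' ((T.cell k).normal j i) x * (T.cell k).normal j i *
        (polyEval (φ k) x - polyEval (φ k') x) ∂(Measure.euclideanHausdorffMeasure (d - 1)))
  + (∑ k, ∑ j, ∫ x in T.boundaryFace k j,
      (T.cell k).trace v x * (T.cell k).normal j i * polyEval (φ k) x
        ∂(Measure.euclideanHausdorffMeasure (d - 1)))
  - (∑ k, ∫ x in (T.cell k).carrier, v x * polyEval (MvPolynomial.pderiv i (φ k)) x)
  + (∑ k, ∑ k' ∈ Finset.Ioi k, ∑ j, ∫ x in T.interiorFace k j k',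
      γ k k' * T.jump v k k' x * (polyEval (φ k) x - polyEval (φ k') x)
        ∂(Measure.euclideanHausdorffMeasure (d - 1)))

/-- `D ∈ V_r^h` satisfies the identity that defines `∂_{h,x_i}^± v`. -/
def IsDiscretePartial (T : Mesh d Ω N) {r : ℕ} (i : Fin d) (s : Side)
    (γ : Fin N → Fin N → ℝ) (v : EuclideanSpace ℝ (Fin d) → ℝ) (D : DGSpace d N r) : Prop :=
  ∀ φ : DGSpace d N r,
    ∑ k, ∫ x in (T.cell k).carrier, polyEval (D k) x * polyEval (φ k) x
      = T.derivFunctional i s γ v φ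

open Classical in
/-- The one-sided discrete partial derivative `∂_{h,x_i}^± v ∈ V_r^h` (the element of `V_r^h` with
the defining identity). -/
noncomputable def sidedPartial (T : Mesh d Ω N) (r : ℕ) (i : Fin d) (s : Side)
    (γ : Fin N → Fin N → ℝ) (v : EuclideanSpace ℝ (Fin d) → ℝ) : DGSpace d N r :=
  if h : ∃ D : DGSpace d N r, T.IsDiscretePartial i s γ v D then h.choose else 0

/-- The three values of the superscript `*` in `∂_{h,x_i}^*`. -/
inductive Star
  | minus
  | plus
  | central

/-- The discrete partial derivative `∂_{h,x_i}^* v ∈ V_r^h`. -/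
noncomputable def discretePartial (T : Mesh d Ω N) (r : ℕ) (i : Fin d) (star : Star)
    (γ : Side → Fin N → Fin N → ℝ) (v : EuclideanSpace ℝ (Fin d) → ℝ) : DGSpace d N r :=
  match star with
  | Star.minus => T.sidedPartial r i Side.minus (γ Side.minus) v
  | Star.plus => T.sidedPartial r i Side.plus (γ Side.plus) v
  | Star.central => (1 / 2 : ℝ) •
      (T.sidedPartial r i Side.minus (γ Side.minus) v
        + T.sidedPartial r i Side.plus (γ Side.plus) v)

/-- `‖f‖_{L²(K)}` for `K = cell k`. -/
noncomputable def cellNorm (T : Mesh d Ω N) (k : Fin N) (f : EuclideanSpace ℝ (Fin d) → ℝ) :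
    ℝ≥0∞ :=
  eLpNorm f 2 (volume.restrict (T.cell k).carrier)

/-- `‖f‖_{L²(𝒯_h)}` for a piecewise function `f = (f_K)_K`. -/
noncomputable def brokenNorm (T : Mesh d Ω N) (f : Fin N → EuclideanSpace ℝ (Fin d) → ℝ) :
    ℝ≥0∞ :=
  (∑ k, T.cellNorm k (f k) ^ 2) ^ (1 / 2 : ℝ)

end Mesh

end DGCalculus

/-!
Let `g` be the weak derivative of `v ∈ H¹(Ω)` in the direction `x_i`. The theorem reduces to the
consistency identity

  `derivFunctional i s γ v φ = ∑_K ∫_K g φ`  for all `φ ∈ V_r^h`  (`Mesh.derivFunctional_eq`).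

Given this, both defining identities say that `D` is the `L²(𝒯_h)` projection of `g` onto `V_r^h`.
It exists and is unique since the mass matrix is positive definite (`Mesh.massMap_injective`), the
two one-sided derivatives and their mean coincide, and, as `V_r^h` is a product over the cells, on
each cell `D` is the best approximation of `g` by polynomials of degree at most `r`
(`Mesh.cellNorm_sub_le`). Derivatives of polynomials of degree at most `r + 1` are among the
competitors.

The consistency identity rests on three facts.

* Green's formula on a polytope `K` (`Polytope.integral_weakPartial_mul`) for functions that are
  continuous up to the boundary and have an integrable weak derivative. The test function is
  multiplied with a smooth cutoff `χ_ε = ∏_l η(dist_l / ε)`, where `dist_l` is the distance to the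
  `l`-th bounding hyperplane. In the coordinates `x = (c - ε t) n + y`, `y ⟂ n`, the derivative of
  `χ_ε` across a facet converges boundedly to `η'(t)` times the indicator of the facet, and surface
  measure on the hyperplane is Lebesgue measure in `y`.
* The facets match (`Mesh.IsGeneric.exists_neighbour`). Almost every point of a facet, with respect
  to surface measure, lies on a single bounding hyperplane of the whole mesh. If such a point is in
  `Ω`, exactly two cells touch it, each with one facet, and their outward normals are opposite.
* `v` does not jump (`Mesh.ae_normalJump_eq_zero`). Summing Green's formula over all cells for a test
  function supported in `Ω` shows that the normal jumps of `v`, in every coordinate direction, are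
  orthogonal to all test functions with respect to surface measure.

Hence the penalty term vanishes, all choices of numerical trace agree, and the fluxes over the faces
add up to the fluxes through the facets of the cells (`Mesh.sum_fluxes_eq`).
-/

/-! ### Coordinates along a unit normal -/

namespace DGCalculus

section Slices

variable {d : ℕ}

/-- The orthogonal decomposition `x = s n + y`, `y ⟂ n`, preserves Lebesgue measure. -/
theorem measurePreserving_slice {n : EuclideanSpace ℝ (Fin d)} (hn : ‖n‖ = 1) :
    MeasurePreserving (fun p : ℝ × (ℝ ∙ n)ᗮ => p.1 • n + (p.2 : EuclideanSpace ℝ (Fin d)))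
      (volume.prod volume) volume ∧
    MeasurableEmbedding
      (fun p : ℝ × (ℝ ∙ n)ᗮ => p.1 • n + (p.2 : EuclideanSpace ℝ (Fin d))) := by
  let e₁ : ℝ ≃ₗᵢ[ℝ] (ℝ ∙ n) := LinearIsometryEquiv.toSpanUnitSingleton n hn
  let e₂ := (Submodule.orthogonalDecomposition (ℝ ∙ n)).symm
  have h₁ : MeasurePreserving (Prod.map e₁ id) (volume.prod (volume : Measure (ℝ ∙ n)ᗮ))
      (volume.prod volume) :=
    e₁.measurePreserving.prod (MeasurePreserving.id _)
  have h₂ := WithLp.volume_preserving_toLp (ℝ ∙ n) (ℝ ∙ n)ᗮ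
  have h₃ := e₂.measurePreserving
  have heq : (fun p : ℝ × (ℝ ∙ n)ᗮ => p.1 • n + (p.2 : EuclideanSpace ℝ (Fin d)))
      = e₂ ∘ (WithLp.toLp 2) ∘ (Prod.map e₁ id) := by
    funext p
    simp [e₁, e₂]
  rw [heq]
  refine ⟨h₃.comp (h₂.comp h₁), ?_⟩
  refine e₂.toHomeomorph.measurableEmbedding.comp (MeasurableEmbedding.comp ?_ ?_)
  · exact (MeasurableEquiv.toLp 2 _).measurableEmbedding
  · exact e₁.toHomeomorph.measurableEmbedding.prodMap MeasurableEmbedding.id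

/-- Change of variables adapted to a layer of width of order `ε` along the hyperplane
`⟪n, x⟫ = c`. -/
theorem integral_eq_integral_layer {n : EuclideanSpace ℝ (Fin d)} (hn : ‖n‖ = 1) (c : ℝ)
    {ε : ℝ} (hε : 0 < ε) (h : EuclideanSpace ℝ (Fin d) → ℝ) :
    ∫ x, h x = ε * ∫ p : ℝ × (ℝ ∙ n)ᗮ,
      h ((c - ε * p.1) • n + (p.2 : EuclideanSpace ℝ (Fin d))) ∂(volume.prod volume) := by
  obtain ⟨hS, hSm⟩ := measurePreserving_slice hn
  rw [← hS.integral_comp hSm]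
  let e : ℝ ≃ₜ ℝ := (Homeomorph.mulLeft₀ (-ε) (by linarith)).trans (Homeomorph.addLeft c)
  have he : ∀ t, e t = c - ε * t := fun t => by simp [e]; ring
  have hmap : Measure.map e volume = ENNReal.ofReal ε⁻¹ • (volume : Measure ℝ) := by
    have h1 : Measure.map ((fun x => c + x) ∘ fun x => (-ε) * x) (volume : Measure ℝ)
        = ENNReal.ofReal ε⁻¹ • (volume : Measure ℝ) := by
      rw [← Measure.map_map (by fun_prop) (by fun_prop), Real.map_volume_mul_left (by linarith),
        Measure.map_smul, Measure.IsAddLeftInvariant.map_add_left_eq_self, inv_neg, abs_neg,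
        abs_of_pos (inv_pos.2 hε)]
    rw [← h1]
    rfl
  have hem : MeasurableEmbedding (Prod.map e (id : (ℝ ∙ n)ᗮ → (ℝ ∙ n)ᗮ)) :=
    e.measurableEmbedding.prodMap MeasurableEmbedding.id
  have hprod : Measure.map (Prod.map e id) ((volume : Measure ℝ).prod (volume : Measure (ℝ ∙ n)ᗮ))
      = ENNReal.ofReal ε⁻¹ • (volume.prod volume) := by
    rw [← Measure.map_prod_map _ _ e.continuous.measurable measurable_id, hmap, Measure.map_id,
      Measure.prod_smul_left]
  have key := hem.integral_map (μ := (volume : Measure ℝ).prod (volume : Measure (ℝ ∙ n)ᗮ))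
    (fun p : ℝ × (ℝ ∙ n)ᗮ => h (p.1 • n + (p.2 : EuclideanSpace ℝ (Fin d))))
  rw [hprod, integral_smul_measure] at key
  simp only [Prod.map_fst, Prod.map_snd, he, id] at key
  rw [← key, ENNReal.toReal_ofReal (inv_pos.2 hε).le, smul_eq_mul, mul_inv_cancel_left₀ hε.ne']

theorem finrank_orthogonal_span_unit {n : EuclideanSpace ℝ (Fin d)} (hn : ‖n‖ = 1) :
    Module.finrank ℝ (ℝ ∙ n)ᗮ = d - 1 := by
  have h0 : n ≠ 0 := by rintro rfl; simp at hn
  have h1 := Submodule.finrank_add_finrank_orthogonal (ℝ ∙ n)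
  rw [finrank_span_singleton h0, finrank_euclideanSpace_fin] at h1
  omega

theorem inner_smul_add_orthogonal {n : EuclideanSpace ℝ (Fin d)} (hn : ‖n‖ = 1) (c : ℝ)
    (y : (ℝ ∙ n)ᗮ) : inner ℝ n (c • n + (y : EuclideanSpace ℝ (Fin d))) = c := by
  have := Submodule.mem_orthogonal_singleton_iff_inner_right.1 y.2
  rw [inner_add_right, this, inner_smul_right, real_inner_self_eq_norm_sq, hn]
  simp

theorem range_vadd_orthogonal {n : EuclideanSpace ℝ (Fin d)} (hn : ‖n‖ = 1) (c : ℝ) :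
    range (fun y : (ℝ ∙ n)ᗮ => c • n + (y : EuclideanSpace ℝ (Fin d)))
      = {x | inner ℝ n x = c} := by
  ext x
  constructor
  · rintro ⟨y, rfl⟩
    exact inner_smul_add_orthogonal hn c y
  · intro hx
    refine ⟨⟨x - c • n, ?_⟩, by simp⟩
    rw [Submodule.mem_orthogonal_singleton_iff_inner_right, inner_sub_right, inner_smul_right,
      real_inner_self_eq_norm_sq, hn]
    simp only [mem_ofPred_eq] at hx
    rw [hx]; ring

theorem isometry_vadd_orthogonal (n : EuclideanSpace ℝ (Fin d)) (c : ℝ) :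
    Isometry (fun y : (ℝ ∙ n)ᗮ => c • n + (y : EuclideanSpace ℝ (Fin d))) :=
  Isometry.of_dist_eq fun y z => by simp [Subtype.dist_eq]

/-- Surface measure on a hyperplane is the Lebesgue measure of the parallel linear hyperplane. -/
theorem map_vadd_orthogonal {n : EuclideanSpace ℝ (Fin d)} (hn : ‖n‖ = 1) (c : ℝ) :
    Measure.map (fun y : (ℝ ∙ n)ᗮ => c • n + (y : EuclideanSpace ℝ (Fin d))) volume
      = (Measure.euclideanHausdorffMeasure (d - 1)).restrict {x | inner ℝ n x = c} := by
  rw [← InnerProductSpace.euclideanHausdorffMeasure_eq_volume, finrank_orthogonal_span_unit hn,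
    (isometry_vadd_orthogonal n c).map_euclideanHausdorffMeasure, range_vadd_orthogonal hn]

theorem measurableEmbedding_vadd_orthogonal (n : EuclideanSpace ℝ (Fin d)) (c : ℝ) :
    MeasurableEmbedding (fun y : (ℝ ∙ n)ᗮ => c • n + (y : EuclideanSpace ℝ (Fin d))) :=
  (isometry_vadd_orthogonal n c).isClosedEmbedding.measurableEmbedding

theorem volume_levelSet_eq_zero {V : Type*} [NormedAddCommGroup V] [InnerProductSpace ℝ V]
    [FiniteDimensional ℝ V] [MeasurableSpace V] [BorelSpace V] (L : V →ₗ[ℝ] ℝ) (hL : L ≠ 0)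
    (b : ℝ) : volume {y | L y = b} = 0 := by
  rcases Set.eq_empty_or_nonempty {y | L y = b} with h | ⟨y₀, hy₀⟩
  · rw [h, measure_empty]
  · have : {y | L y = b} = (fun y => -y₀ + y) ⁻¹' (LinearMap.ker L : Set V) := by
      ext y
      simp only [mem_ofPred_eq] at hy₀
      simp [hy₀, add_comm (-b), ← sub_eq_add_neg, sub_eq_zero]
    rw [this, measure_preimage_add]
    exact Measure.addHaar_submodule _ _ (by rwa [Ne, LinearMap.ker_eq_top])

/-- Two distinct hyperplanes meet in a set without surface measure. -/
theorem hausdorff_inter_hyperplanes {n n' : EuclideanSpace ℝ (Fin d)} (hn : ‖n‖ = 1)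
    (hn' : ‖n'‖ = 1) {c c' : ℝ} (h₁ : (n', c') ≠ (n, c)) (h₂ : (n', c') ≠ (-n, -c)) :
    Measure.euclideanHausdorffMeasure (d - 1)
      ({x | inner ℝ n x = c} ∩ {x : EuclideanSpace ℝ (Fin d) | inner ℝ n' x = c'}) = 0 := by
  have hm : MeasurableSet {x : EuclideanSpace ℝ (Fin d) | inner ℝ n' x = c'} :=
    measurableSet_eq_fun (by fun_prop) measurable_const
  rw [inter_comm, ← Measure.restrict_apply hm, ← map_vadd_orthogonal hn,
    (measurableEmbedding_vadd_orthogonal n c).map_apply]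
  let L : (ℝ ∙ n)ᗮ →ₗ[ℝ] ℝ := (innerₛₗ ℝ n').comp (ℝ ∙ n)ᗮ.subtype
  have hset : (fun y : (ℝ ∙ n)ᗮ => c • n + (y : EuclideanSpace ℝ (Fin d))) ⁻¹'
      {x | inner ℝ n' x = c'} = {y | L y = c' - c * inner ℝ n' n} := by
    ext y
    simp only [mem_preimage, mem_ofPred_eq, inner_add_right, inner_smul_right, L,
      LinearMap.comp_apply, Submodule.subtype_apply, innerₛₗ_apply_apply]
    constructor <;> intro h <;> linarith
  rw [hset]
  by_cases hL : L = 0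
  · -- `n'` is orthogonal to everything orthogonal to `n`, hence `n' = ± n`: parallel hyperplanes
    have hmem : n' ∈ (ℝ ∙ n)ᗮᗮ := by
      intro y hy
      rw [real_inner_comm]
      exact congrArg (fun M : (ℝ ∙ n)ᗮ →ₗ[ℝ] ℝ => M ⟨y, hy⟩) hL
    rw [Submodule.orthogonal_orthogonal, Submodule.mem_span_singleton] at hmem
    obtain ⟨a, rfl⟩ := hmem
    rw [norm_smul, hn, mul_one, Real.norm_eq_abs] at hn'
    convert measure_empty (μ := (volume : Measure (ℝ ∙ n)ᗮ))
    rw [hL, Set.eq_empty_iff_forall_notMem]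
    intro y hy
    simp only [LinearMap.zero_apply, mem_ofPred_eq, inner_smul_left, real_inner_self_eq_norm_sq,
      hn, conj_trivial] at hy
    rcases (abs_eq zero_le_one).1 hn' with rfl | rfl
    · exact h₁ (Prod.ext (by simp) (by simp; linarith))
    · exact h₂ (Prod.ext (by simp) (by simp; linarith))
  · exact volume_levelSet_eq_zero L hL _

end Slices
end DGCalculus

/-! ### Elementary properties of polytopes -/

namespace DGCalculus

namespace Polytope

variable {d : ℕ} (K : Polytope d)

theorem isOpen_carrier : IsOpen K.carrier := by
  simp only [carrier, Set.ofPred_forall]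
  exact isOpen_iInter_of_finite fun j => isOpen_lt (by fun_prop) continuous_const

theorem isBounded_carrier : Bornology.IsBounded K.carrier := K.bounded

theorem isCompact_closure : IsCompact (closure K.carrier) := K.isBounded_carrier.isCompact_closure

theorem inner_le_of_mem_closure {x : EuclideanSpace ℝ (Fin d)} (hx : x ∈ closure K.carrier)
    (j : Fin K.numFacets) : inner ℝ (K.normal j) x ≤ K.offset j := by
  have hc : IsClosed {x : EuclideanSpace ℝ (Fin d) | inner ℝ (K.normal j) x ≤ K.offset j} :=
    isClosed_le (by fun_prop) continuous_const
  exact closure_minimal (fun y hy => (hy j).le) hc hx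

theorem isCompact_facet (j : Fin K.numFacets) : IsCompact (K.facet j) :=
  K.isCompact_closure.inter_right (isClosed_eq (by fun_prop) continuous_const)

theorem facet_subset_closure (j : Fin K.numFacets) : K.facet j ⊆ closure K.carrier :=
  fun _ hx => hx.1

theorem volume_carrier_lt_top : volume K.carrier < ⊤ := K.isBounded_carrier.measure_lt_top

theorem hausdorff_facet_lt_top (j : Fin K.numFacets) :
    Measure.euclideanHausdorffMeasure (d - 1) (K.facet j) < ⊤ := by
  have h : K.facet j ∩ {x | inner ℝ (K.normal j) x = K.offset j} = K.facet j :=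
    inter_eq_left.2 fun x hx => hx.2
  rw [← h, ← Measure.restrict_apply (K.isCompact_facet j).measurableSet,
    ← map_vadd_orthogonal (K.norm_normal j),
    (measurableEmbedding_vadd_orthogonal _ _).map_apply]
  exact ((isometry_vadd_orthogonal _ _).isClosedEmbedding.isCompact_preimage
    (K.isCompact_facet j)).measure_lt_top

theorem integrableOn_of_subset_facet {j : Fin K.numFacets} {S A : Set (EuclideanSpace ℝ (Fin d))}
    {f : EuclideanSpace ℝ (Fin d) → ℝ} (hS : IsCompact S) (hf : ContinuousOn f S)
    (hA : MeasurableSet A) (hAS : A ⊆ S) (hAj : A ⊆ K.facet j) :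
    IntegrableOn f A (Measure.euclideanHausdorffMeasure (d - 1)) := by
  obtain ⟨M, hM⟩ := hS.exists_bound_of_continuousOn hf
  have hfin : IsFiniteMeasure ((Measure.euclideanHausdorffMeasure (d - 1) :
      Measure (EuclideanSpace ℝ (Fin d))).restrict A) :=
    isFiniteMeasure_restrict.2 ((measure_mono hAj).trans_lt (K.hausdorff_facet_lt_top j)).ne
  exact Integrable.of_bound ((hf.mono hAS).aestronglyMeasurable hA) M
    ((ae_restrict_iff' hA).2 (ae_of_all _ fun x hx => hM x (hAS hx)))

/-- A nonempty polytope has no two opposite bounding hyperplanes. -/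
theorem not_opposite (j l : Fin K.numFacets) :
    (K.normal l, K.offset l) ≠ (-K.normal j, -K.offset j) := by
  intro h
  obtain ⟨x, hx⟩ := K.nonempty
  have h1 := hx j
  have h2 := hx l
  rw [Prod.mk.injEq] at h
  rw [h.1, h.2, inner_neg_left] at h2
  linarith

/-- Almost every point of a bounding hyperplane lies on no other bounding hyperplane. -/
theorem ae_inner_ne_offset (j : Fin K.numFacets) :
    ∀ᵐ x ∂((Measure.euclideanHausdorffMeasure (d - 1)).restrict
        {x : EuclideanSpace ℝ (Fin d) | inner ℝ (K.normal j) x = K.offset j}),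
      ∀ l, l ≠ j → inner ℝ (K.normal l) x ≠ K.offset l := by
  rw [ae_all_iff]
  intro l
  by_cases hl : l = j
  · simp [hl]
  have hm : MeasurableSet {x : EuclideanSpace ℝ (Fin d) | inner ℝ (K.normal l) x = K.offset l} :=
    measurableSet_eq_fun (by fun_prop) measurable_const
  have h0 := hausdorff_inter_hyperplanes (K.norm_normal j) (K.norm_normal l)
    (c := K.offset j) (c' := K.offset l) (fun h => hl (K.distinct h)) (K.not_opposite j l)
  rw [inter_comm, ← Measure.restrict_apply hm] at h0
  refine (measure_eq_zero_iff_ae_notMem.1 h0).mono fun x hx _ => hx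

end Polytope

/-! ### Green's formula on a polytope -/

/-- A smooth monotone profile equal to `0` on `(-∞, 1]` and to `1` on `[2, ∞)`. -/
noncomputable def profile (t : ℝ) : ℝ := Real.smoothTransition (t - 1)

theorem contDiff_profile : ContDiff ℝ ∞ profile :=
  Real.smoothTransition.contDiff.comp (contDiff_id.sub contDiff_const)

theorem profile_of_le {t : ℝ} (h : t ≤ 1) : profile t = 0 :=
  Real.smoothTransition.zero_of_nonpos (by linarith)

theorem profile_of_ge {t : ℝ} (h : 2 ≤ t) : profile t = 1 :=
  Real.smoothTransition.one_of_one_le (by linarith)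

theorem abs_profile_le (t : ℝ) : |profile t| ≤ 1 := by
  rw [profile, abs_of_nonneg (Real.smoothTransition.nonneg _)]
  exact Real.smoothTransition.le_one _

theorem hasDerivAt_profile (t : ℝ) : HasDerivAt profile (deriv profile t) t :=
  ((contDiff_profile.differentiable (by simp)) t).hasDerivAt

theorem continuous_deriv_profile : Continuous (deriv profile) :=
  contDiff_profile.continuous_deriv (by simp)

theorem deriv_profile_of_notMem {t : ℝ} (h : t ∉ Icc (1 : ℝ) 2) : deriv profile t = 0 := by
  rw [mem_Icc, not_and_or, not_le, not_le] at h
  rcases h with h | h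
  · have : profile =ᶠ[𝓝 t] fun _ => (0 : ℝ) :=
      (eventually_lt_nhds h).mono fun s hs => profile_of_le hs.le
    rw [this.deriv_eq, deriv_const]
  · have : profile =ᶠ[𝓝 t] fun _ => (1 : ℝ) :=
      (eventually_gt_nhds h).mono fun s hs => profile_of_ge hs.le
    rw [this.deriv_eq, deriv_const]

theorem integrable_deriv_profile : Integrable (deriv profile) :=
  continuous_deriv_profile.integrable_of_hasCompactSupport
    (HasCompactSupport.intro isCompact_Icc fun _ h => deriv_profile_of_notMem h)

theorem integral_deriv_profile : ∫ t, deriv profile t = 1 := by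
  have h0 : Tendsto profile atBot (𝓝 0) :=
    tendsto_const_nhds.congr' ((eventually_le_atBot 1).mono fun t ht => (profile_of_le ht).symm)
  have h1 : Tendsto profile atTop (𝓝 1) :=
    tendsto_const_nhds.congr' ((eventually_ge_atTop 2).mono fun t ht => (profile_of_ge ht).symm)
  rw [integral_of_hasDerivAt_of_tendsto hasDerivAt_profile integrable_deriv_profile h0 h1, sub_zero]

namespace Polytope

variable {d : ℕ} (K : Polytope d)

/-- The rescaled distance of `x` to the `l`-th bounding hyperplane of `K`. -/
noncomputable def depth (l : Fin K.numFacets) (ε : ℝ) (x : EuclideanSpace ℝ (Fin d)) : ℝ :=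
  (K.offset l - inner ℝ (K.normal l) x) / ε

/-- A smooth cutoff supported in the open cell, with values in `[0, 1]`, that tends to the
indicator function of the cell as `ε → 0`. -/
noncomputable def cutoff (ε : ℝ) (x : EuclideanSpace ℝ (Fin d)) : ℝ :=
  ∏ l, profile (K.depth l ε x)

theorem continuous_depth (l : Fin K.numFacets) (ε : ℝ) : Continuous (K.depth l ε) := by
  unfold depth; fun_prop

theorem abs_prod_profile_le (s : Finset (Fin K.numFacets)) (ε : ℝ)
    (x : EuclideanSpace ℝ (Fin d)) : |∏ l ∈ s, profile (K.depth l ε x)| ≤ 1 := by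
  rw [Finset.abs_prod]
  exact Finset.prod_le_one (fun _ _ => abs_nonneg _) fun _ _ => abs_profile_le _

theorem measurable_prod_profile (s : Finset (Fin K.numFacets)) (ε : ℝ) :
    Measurable fun x => ∏ l ∈ s, profile (K.depth l ε x) :=
  Finset.measurable_fun_prod _ fun l _ =>
    (contDiff_profile.continuous.comp (K.continuous_depth l ε)).measurable

/-- The derivative of the cutoff across the `j`-th facet concentrates to the surface measure of
that facet. -/
theorem tendsto_integral_layer {f : EuclideanSpace ℝ (Fin d) → ℝ}
    (hf : ContinuousOn f (closure K.carrier)) (j : Fin K.numFacets) :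
    Tendsto (fun ε : ℝ => ∫ x in K.carrier, f x * (ε⁻¹ * deriv profile (K.depth j ε x) *
        ∏ l ∈ Finset.univ.erase j, profile (K.depth l ε x))) (𝓝[>] 0)
      (𝓝 (∫ x in K.facet j, f x ∂(Measure.euclideanHausdorffMeasure (d - 1)))) := by
  classical
  set n := K.normal j with hn_def
  set c := K.offset j with hc_def
  have hn : ‖n‖ = 1 := K.norm_normal j
  let Y := (ℝ ∙ n)ᗮ
  let P : ℝ → ℝ × Y → EuclideanSpace ℝ (Fin d) := fun ε p => (c - ε * p.1) • n + p.2
  have hP : ∀ ε, Continuous (P ε) := fun ε => by fun_prop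
  let H : ℝ → ℝ × Y → ℝ := fun ε p => K.carrier.indicator f (P ε p) *
    (deriv profile p.1 * ∏ l ∈ Finset.univ.erase j, profile (K.depth l ε (P ε p)))
  let H₀ : ℝ × Y → ℝ := fun p => deriv profile p.1 *
    (K.facet j).indicator f (c • n + (p.2 : EuclideanSpace ℝ (Fin d)))
  have hdepth : ∀ ε > 0, ∀ p, K.depth j ε (P ε p) = p.1 := by
    intro ε hε p
    simp only [depth, P, ← hn_def, ← hc_def]
    rw [inner_smul_add_orthogonal hn]
    field_simp
    ring
  -- rewriting the layer integral in the coordinates `(t, y)`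
  have hL : ∀ ε > 0, ∫ x in K.carrier, f x * (ε⁻¹ * deriv profile (K.depth j ε x) *
        ∏ l ∈ Finset.univ.erase j, profile (K.depth l ε x))
      = ∫ p, H ε p ∂(volume.prod volume) := by
    intro ε hε
    rw [← integral_indicator K.isOpen_carrier.measurableSet,
      integral_eq_integral_layer hn c hε, ← integral_const_mul]
    refine integral_congr_ae (ae_of_all _ fun p => ?_)
    change ε * K.carrier.indicator _ (P ε p) = _
    by_cases hp : P ε p ∈ K.carrier
    · simp only [H, indicator_of_mem hp, hdepth ε hε]
      field_simp
    · simp only [H, indicator_of_notMem hp]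
      simp
  have hR : ∫ p, H₀ p ∂(volume.prod volume)
      = ∫ x in K.facet j, f x ∂(Measure.euclideanHausdorffMeasure (d - 1)) := by
    have h1 := integral_prod_mul (μ := (volume : Measure ℝ)) (ν := (volume : Measure Y))
      (deriv profile) (fun y => (K.facet j).indicator f (c • n + (y : EuclideanSpace ℝ (Fin d))))
    rw [h1, integral_deriv_profile, one_mul,
      ← (measurableEmbedding_vadd_orthogonal n c).integral_map, map_vadd_orthogonal hn,
      integral_indicator (K.isCompact_facet j).measurableSet,
      Measure.restrict_restrict (K.isCompact_facet j).measurableSet,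
      inter_eq_left.2 fun x hx => hx.2]
  rw [← hR]
  refine Tendsto.congr' (f₁ := fun ε => ∫ p, H ε p ∂(volume.prod volume))
    (eventually_mem_nhdsWithin.mono fun ε hε => (hL ε hε).symm) ?_
  obtain ⟨M, hM⟩ := K.isCompact_closure.exists_bound_of_continuousOn hf
  obtain ⟨R, hR⟩ := K.isBounded_carrier.exists_norm_le
  have hM0 : 0 ≤ M := by
    obtain ⟨x, hx⟩ := K.nonempty
    exact (norm_nonneg _).trans (hM x (subset_closure hx))
  refine tendsto_integral_filter_of_dominated_convergence
    (fun p => |deriv profile p.1| *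
      (Metric.closedBall (0 : Y) (R + |c| + 2)).indicator (fun _ => M) p.2) ?_ ?_ ?_ ?_
  · refine Eventually.of_forall fun ε => ?_
    have hmeas : Measurable (K.carrier.indicator f) := by
      rw [← Set.piecewise_eq_indicator]
      exact (hf.mono subset_closure).measurable_piecewise continuousOn_const
        K.isOpen_carrier.measurableSet
    have h2 : Measurable fun p => ∏ l ∈ Finset.univ.erase j, profile (K.depth l ε (P ε p)) :=
      (K.measurable_prod_profile _ ε).comp (hP ε).measurable
    exact ((hmeas.comp (hP ε).measurable).mul
      ((continuous_deriv_profile.measurable.comp measurable_fst).mul h2)).aestronglyMeasurable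
  · filter_upwards [Ioo_mem_nhdsGT (zero_lt_one' ℝ)] with ε hε
    refine ae_of_all _ fun p => ?_
    by_cases ht : p.1 ∈ Icc (1 : ℝ) 2
    swap
    · simp [H, deriv_profile_of_notMem ht]
    by_cases hp : P ε p ∈ K.carrier
    swap
    · simp only [H, indicator_of_notMem hp, zero_mul, norm_zero]
      exact mul_nonneg (abs_nonneg _) (indicator_nonneg (fun _ _ => hM0) _)
    have hy : p.2 ∈ Metric.closedBall (0 : Y) (R + |c| + 2) := by
      rw [mem_closedBall_zero_iff]
      have h1 : ‖(p.2 : EuclideanSpace ℝ (Fin d))‖ ≤ ‖P ε p‖ + ‖(c - ε * p.1) • n‖ := by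
        have : (p.2 : EuclideanSpace ℝ (Fin d)) = P ε p - (c - ε * p.1) • n := by simp [P]
        rw [this]
        exact norm_sub_le _ _
      have h2 : ‖(c - ε * p.1) • n‖ ≤ |c| + 2 := by
        rw [norm_smul, hn, mul_one, Real.norm_eq_abs]
        refine (abs_sub _ _).trans ?_
        rw [abs_mul, abs_of_pos hε.1, abs_of_pos (zero_lt_one.trans_le ht.1)]
        nlinarith [hε.1, hε.2, ht.1, ht.2]
      have h3 := hR _ hp
      rw [Submodule.coe_norm]
      linarith
    simp only [H, indicator_of_mem hp, indicator_of_mem hy, norm_mul, Real.norm_eq_abs]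
    have h1 := hM _ (subset_closure hp)
    rw [Real.norm_eq_abs] at h1
    have h2 := K.abs_prod_profile_le (Finset.univ.erase j) ε (P ε p)
    calc |f (P ε p)| * (|deriv profile p.1| * |∏ l ∈ Finset.univ.erase j,
            profile (K.depth l ε (P ε p))|)
        ≤ M * (|deriv profile p.1| * 1) := by gcongr
      _ = |deriv profile p.1| * M := by ring
  · refine Integrable.mul_prod (f := fun t => |deriv profile t|) integrable_deriv_profile.abs ?_
    exact (integrable_indicator_iff measurableSet_closedBall).2
      (integrableOn_const (isCompact_closedBall _ _).measure_lt_top.ne)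
  · -- almost every point of the hyperplane lies on no other bounding hyperplane
    have hae : ∀ᵐ y : Y, ∀ l, l ≠ j →
        inner ℝ (K.normal l) (c • n + (y : EuclideanSpace ℝ (Fin d))) ≠ K.offset l := by
      have := K.ae_inner_ne_offset j
      rw [← map_vadd_orthogonal (K.norm_normal j),
        (measurableEmbedding_vadd_orthogonal _ _).ae_map_iff] at this
      exact this
    filter_upwards [Measure.quasiMeasurePreserving_snd.ae hae] with p hp
    by_cases ht : p.1 ∈ Icc (1 : ℝ) 2
    swap
    · simp [H, H₀, deriv_profile_of_notMem ht]
    set x₀ : EuclideanSpace ℝ (Fin d) := c • n + (p.2 : EuclideanSpace ℝ (Fin d)) with hx₀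
    have hlim : Tendsto (fun ε => P ε p) (𝓝[>] 0) (𝓝 x₀) := by
      have : Continuous fun ε => P ε p := by fun_prop
      have h := (this.tendsto 0).mono_left (nhdsWithin_le_nhds (s := Ioi 0))
      simpa [P] using h
    by_cases hF : x₀ ∈ K.facet j
    · have hstrict : ∀ l, l ≠ j → inner ℝ (K.normal l) x₀ < K.offset l := fun l hl =>
        lt_of_le_of_ne (K.inner_le_of_mem_closure hF.1 l) (hp l hl)
      have hone : ∀ l, l ≠ j → ∀ᶠ ε in 𝓝[>] (0 : ℝ), 2 ≤ K.depth l ε (P ε p) := by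
        intro l hl
        have h1 : Tendsto (fun ε => K.offset l - inner ℝ (K.normal l) (P ε p)) (𝓝[>] 0)
            (𝓝 (K.offset l - inner ℝ (K.normal l) x₀)) :=
          tendsto_const_nhds.sub (tendsto_const_nhds.inner hlim)
        have h2 := h1.pos_mul_atTop (sub_pos.2 (hstrict l hl)) tendsto_inv_nhdsGT_zero
        exact h2.eventually_ge_atTop 2
      have hone' := (eventually_all.2 fun l => eventually_all.2 fun hl => hone l hl)
      have hin : ∀ᶠ ε in 𝓝[>] (0 : ℝ), P ε p ∈ K.carrier := by
        filter_upwards [hone', self_mem_nhdsWithin] with ε h1 hε l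
        by_cases hl : l = j
        · have h2 := hdepth ε hε p
          subst hl
          have h3 : 0 < K.depth l ε (P ε p) := by rw [h2]; exact zero_lt_one.trans_le ht.1
          have := (div_pos_iff_of_pos_right hε).1 h3
          linarith
        · have h3 : 0 < K.depth l ε (P ε p) := zero_lt_two.trans_le (h1 l hl)
          have := (div_pos_iff_of_pos_right hε).1 h3
          linarith
      have hfl : Tendsto (fun ε => f (P ε p)) (𝓝[>] 0) (𝓝 (f x₀)) :=
        (hf x₀ hF.1).tendsto.comp (tendsto_nhdsWithin_iff.2
          ⟨hlim, hin.mono fun ε h => subset_closure h⟩)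
      have hfl' := hfl.mul_const (deriv profile p.1)
      have : H₀ p = f x₀ * deriv profile p.1 := by
        simp only [H₀, ← hx₀, indicator_of_mem hF, mul_comm]
      rw [this]
      refine hfl'.congr' ?_
      filter_upwards [hin, hone'] with ε h1 h2
      simp only [H, indicator_of_mem h1]
      rw [Finset.prod_eq_one fun l hl => profile_of_ge (h2 l (Finset.ne_of_mem_erase hl)), mul_one]
    · have hnc : x₀ ∉ closure K.carrier := fun h => hF ⟨h, inner_smul_add_orthogonal hn c p.2⟩
      have : H₀ p = 0 := by simp only [H₀, ← hx₀, indicator_of_notMem hF, mul_zero]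
      rw [this]
      refine tendsto_const_nhds.congr' ?_
      filter_upwards [hlim.eventually (isClosed_closure.isOpen_compl.mem_nhds hnc)] with ε h
      simp only [H, indicator_of_notMem fun h' => h (subset_closure h'), zero_mul]

theorem tendsto_cutoff {x : EuclideanSpace ℝ (Fin d)} (hx : x ∈ K.carrier) :
    Tendsto (fun ε => K.cutoff ε x) (𝓝[>] 0) (𝓝 1) := by
  have h : ∀ l, ∀ᶠ ε in 𝓝[>] (0 : ℝ), 2 ≤ K.depth l ε x := fun l =>
    (tendsto_inv_nhdsGT_zero.const_mul_atTop (sub_pos.2 (hx l))).eventually_ge_atTop 2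
  refine tendsto_const_nhds.congr' ((eventually_all.2 h).mono fun ε hε => ?_)
  exact (Finset.prod_eq_one fun l _ => profile_of_ge (hε l)).symm

theorem tendsto_integral_mul_cutoff {h : EuclideanSpace ℝ (Fin d) → ℝ}
    (hh : IntegrableOn h K.carrier) :
    Tendsto (fun ε => ∫ x in K.carrier, h x * K.cutoff ε x) (𝓝[>] 0)
      (𝓝 (∫ x in K.carrier, h x)) := by
  refine tendsto_integral_filter_of_dominated_convergence (fun x => ‖h x‖) ?_ ?_ hh.norm ?_
  · exact Eventually.of_forall fun ε =>
      hh.1.mul (K.measurable_prod_profile _ ε).aestronglyMeasurable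
  · refine Eventually.of_forall fun ε => ae_of_all _ fun x => ?_
    rw [norm_mul]
    exact mul_le_of_le_one_right (norm_nonneg _) (K.abs_prod_profile_le _ ε x)
  · filter_upwards [ae_restrict_mem K.isOpen_carrier.measurableSet] with x hx
    simpa using (K.tendsto_cutoff hx).const_mul (h x)

theorem tsupport_cutoff_subset {ε : ℝ} (hε : 0 < ε) : tsupport (K.cutoff ε) ⊆ K.carrier := by
  have hc : IsClosed {x : EuclideanSpace ℝ (Fin d) | ∀ l, 1 ≤ K.depth l ε x} := by
    simp only [Set.ofPred_forall]
    exact isClosed_iInter fun l => isClosed_le continuous_const (K.continuous_depth l ε)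
  have hs : Function.support (K.cutoff ε) ⊆ {x | ∀ l, 1 ≤ K.depth l ε x} := by
    intro x hx l
    by_contra! h
    exact hx (Finset.prod_eq_zero (Finset.mem_univ l) (profile_of_le h.le))
  intro x hx l
  have h1 : 0 < K.depth l ε x := zero_lt_one.trans_le (closure_minimal hs hc hx l)
  have := (div_pos_iff_of_pos_right hε).1 h1
  linarith

theorem hasCompactSupport_cutoff {ε : ℝ} (hε : 0 < ε) : HasCompactSupport (K.cutoff ε) :=
  K.isCompact_closure.of_isClosed_subset (isClosed_tsupport _)
    ((K.tsupport_cutoff_subset hε).trans subset_closure)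

theorem contDiff_cutoff (ε : ℝ) : ContDiff ℝ ∞ (K.cutoff ε) := by
  unfold cutoff depth
  exact contDiff_prod fun l _ => contDiff_profile.comp
    ((contDiff_const.sub (contDiff_const.inner ℝ contDiff_id)).div_const ε)

theorem hasFDerivAt_depth (l : Fin K.numFacets) (ε : ℝ) (x : EuclideanSpace ℝ (Fin d)) :
    HasFDerivAt (K.depth l ε) (-(ε⁻¹ • innerSL ℝ (K.normal l))) x := by
  have h := ((innerSL ℝ (K.normal l)).hasFDerivAt (x := x)).const_sub (K.offset l)
  have h2 := h.mul_const ε⁻¹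
  have h3 : HasFDerivAt (K.depth l ε) (ε⁻¹ • -(innerSL ℝ (K.normal l))) x := by
    simpa only [depth, div_eq_mul_inv, innerSL_apply_apply] using! h2
  rwa [smul_neg] at h3

/-- The derivative of the cutoff is a sum of layers, one along each facet. -/
theorem fderiv_cutoff (ε : ℝ) (x : EuclideanSpace ℝ (Fin d)) (i : Fin d) :
    fderiv ℝ (K.cutoff ε) x (EuclideanSpace.single i 1)
      = -∑ j, K.normal j i * (ε⁻¹ * deriv profile (K.depth j ε x) *
        ∏ l ∈ Finset.univ.erase j, profile (K.depth l ε x)) := by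
  classical
  have h : ∀ l ∈ Finset.univ, HasFDerivAt (fun x => profile (K.depth l ε x))
      (deriv profile (K.depth l ε x) • -(ε⁻¹ • innerSL ℝ (K.normal l))) x := fun l _ =>
    (hasDerivAt_profile _).comp_hasFDerivAt x (K.hasFDerivAt_depth l ε x)
  have h2 := HasFDerivAt.finsetProd h
  have h3 : HasFDerivAt (K.cutoff ε) _ x := h2
  rw [h3.fderiv]
  simp only [sum_apply, smul_apply,
    neg_apply, innerSL_apply_apply, EuclideanSpace.inner_single_right,
    ← Finset.sum_neg_distrib, smul_eq_mul]
  refine Finset.sum_congr rfl fun j _ => ?_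
  simp
  ring

/-- Green's formula on a polytope, for a function `v` that is continuous up to the boundary, with
boundary values `f`, and has an integrable weak derivative. -/
theorem integral_weakPartial_mul {i : Fin d} {v g f φ : EuclideanSpace ℝ (Fin d) → ℝ}
    (hf : ContinuousOn f (closure K.carrier)) (hvf : EqOn v f K.carrier)
    (hg : IsWeakPartial K.carrier i v g) (hgi : IntegrableOn g K.carrier)
    (hφ : ContDiff ℝ ∞ φ) :
    ∫ x in K.carrier, g x * φ x
      = -(∫ x in K.carrier, v x * fderiv ℝ φ x (EuclideanSpace.single i 1))
        + ∑ j, ∫ x in K.facet j, f x * K.normal j i * φ x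
            ∂(Measure.euclideanHausdorffMeasure (d - 1)) := by
  have hm := K.isOpen_carrier.measurableSet
  have hint : ∀ h : EuclideanSpace ℝ (Fin d) → ℝ, ContinuousOn h (closure K.carrier) →
      IntegrableOn h K.carrier := fun h hh =>
    (hh.integrableOn_compact K.isCompact_closure).mono_set subset_closure
  have hdφ : Continuous fun x => fderiv ℝ φ x (EuclideanSpace.single i 1) :=
    (hφ.continuous_fderiv (by simp)).clm_apply continuous_const
  have hcut : ∀ ε, Continuous (K.cutoff ε) := fun ε => (K.contDiff_cutoff ε).continuous
  have hlayer : ∀ ε j, Continuous fun x => ε⁻¹ * deriv profile (K.depth j ε x) *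
        ∏ l ∈ Finset.univ.erase j, profile (K.depth l ε x) := fun ε j =>
    (continuous_const.mul (continuous_deriv_profile.comp (K.continuous_depth j ε))).mul
      (continuous_finsetProd _ fun l _ => contDiff_profile.continuous.comp (K.continuous_depth l ε))
  have hfφ : ContinuousOn (fun x => f x * φ x) (closure K.carrier) :=
    hf.mul hφ.continuous.continuousOn
  have key : ∀ ε > 0,
      (∫ x in K.carrier, (f x * fderiv ℝ φ x (EuclideanSpace.single i 1)) * K.cutoff ε x)
        - ∑ j, K.normal j i * ∫ x in K.carrier, f x * φ x *
            (ε⁻¹ * deriv profile (K.depth j ε x) *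
              ∏ l ∈ Finset.univ.erase j, profile (K.depth l ε x))
      = -∫ x in K.carrier, g x * φ x * K.cutoff ε x := by
    intro ε hε
    have h := hg.2.2 (fun x => φ x * K.cutoff ε x) (hφ.mul (K.contDiff_cutoff ε))
      (K.hasCompactSupport_cutoff hε).mul_left
      ((tsupport_mul_subset_right).trans (K.tsupport_cutoff_subset hε))
    simp only [← mul_assoc] at h
    simp only [← mul_assoc]
    rw [← h]
    have hI : ∀ x ∈ K.carrier, v x * fderiv ℝ (fun x => φ x * K.cutoff ε x) x
          (EuclideanSpace.single i 1)
        = (f x * fderiv ℝ φ x (EuclideanSpace.single i 1)) * K.cutoff ε x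
          - ∑ j, K.normal j i * (f x * φ x * (ε⁻¹ * deriv profile (K.depth j ε x) *
              ∏ l ∈ Finset.univ.erase j, profile (K.depth l ε x))) := by
      intro x hx
      rw [hvf hx, fderiv_fun_mul (hφ.differentiable (by simp) x)
        ((K.contDiff_cutoff ε).differentiable (by simp) x)]
      simp only [add_apply, smul_apply, smul_eq_mul,
        K.fderiv_cutoff ε x i]
      have : ∑ j, K.normal j i * (f x * φ x * (ε⁻¹ * deriv profile (K.depth j ε x) *
              ∏ l ∈ Finset.univ.erase j, profile (K.depth l ε x)))
          = f x * φ x * ∑ j, K.normal j i * (ε⁻¹ * deriv profile (K.depth j ε x) *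
              ∏ l ∈ Finset.univ.erase j, profile (K.depth l ε x)) := by
        rw [Finset.mul_sum]
        exact Finset.sum_congr rfl fun j _ => by ring
      rw [this]
      ring
    rw [setIntegral_congr_fun hm hI, integral_sub, integral_finsetSum]
    · simp only [integral_const_mul, mul_assoc]
    · exact fun j _ => (hint _ (hfφ.mul (hlayer ε j).continuousOn)).const_mul _
    · exact hint _ ((hf.mul hdφ.continuousOn).mul (hcut ε).continuousOn)
    · exact integrable_finsetSum _ fun j _ =>
        (hint _ (hfφ.mul (hlayer ε j).continuousOn)).const_mul _
  have hgφ : IntegrableOn (fun x => g x * φ x) K.carrier := by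
    obtain ⟨M, hM⟩ := K.isCompact_closure.exists_bound_of_continuousOn hφ.continuous.continuousOn
    exact hgi.mul_bdd (c := M) hφ.continuous.aestronglyMeasurable
      ((ae_restrict_iff' hm).2 (ae_of_all _ fun x hx => hM x (subset_closure hx)))
  have hfdφ : ContinuousOn (fun x => f x * fderiv ℝ φ x (EuclideanSpace.single i 1))
      (closure K.carrier) := hf.mul hdφ.continuousOn
  have hL := (K.tendsto_integral_mul_cutoff (hint _ hfdφ)).sub
    (tendsto_finsetSum Finset.univ fun j _ =>
      (K.tendsto_integral_layer hfφ j).const_mul (K.normal j i))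
  have hR := (K.tendsto_integral_mul_cutoff hgφ).neg
  have huniq := tendsto_nhds_unique (hL.congr' ((eventually_mem_nhdsWithin (a := (0 : ℝ)) (s := Ioi 0)).mono
    fun ε hε => key ε hε)) hR
  have h1 : ∫ x in K.carrier, v x * fderiv ℝ φ x (EuclideanSpace.single i 1)
      = ∫ x in K.carrier, f x * fderiv ℝ φ x (EuclideanSpace.single i 1) :=
    setIntegral_congr_fun hm fun x hx => by simp only [hvf hx]
  have h2 : ∀ j, ∫ x in K.facet j, f x * K.normal j i * φ x
        ∂(Measure.euclideanHausdorffMeasure (d - 1))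
      = K.normal j i * ∫ x in K.facet j, f x * φ x
        ∂(Measure.euclideanHausdorffMeasure (d - 1)) := fun j => by
    rw [← integral_const_mul]
    exact integral_congr_ae (ae_of_all _ fun x => by ring)
  rw [h1, Finset.sum_congr rfl fun j _ => h2 j]
  linarith

end Polytope
end DGCalculus

/-! ### Generic points of the facets of a mesh -/

namespace DGCalculus
namespace Mesh

variable {d N : ℕ} {Ω : Set (EuclideanSpace ℝ (Fin d))} (T : Mesh d Ω N)

/-- `x` is generic for the mesh if any two bounding hyperplanes of cells that pass through `x`
coincide, up to orientation. -/
def IsGeneric (x : EuclideanSpace ℝ (Fin d)) : Prop :=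
  ∀ k (j : Fin (T.cell k).numFacets) l (m : Fin (T.cell l).numFacets),
    inner ℝ ((T.cell k).normal j) x = (T.cell k).offset j →
    inner ℝ ((T.cell l).normal m) x = (T.cell l).offset m →
    ((T.cell l).normal m, (T.cell l).offset m) = ((T.cell k).normal j, (T.cell k).offset j) ∨
    ((T.cell l).normal m, (T.cell l).offset m) = (-(T.cell k).normal j, -(T.cell k).offset j)

theorem ae_isGeneric :
    ∀ᵐ x ∂(Measure.euclideanHausdorffMeasure (d - 1) : Measure (EuclideanSpace ℝ (Fin d))),
      T.IsGeneric x := by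
  unfold IsGeneric
  simp only [ae_all_iff]
  intro k j l m
  by_cases h : ((T.cell l).normal m, (T.cell l).offset m)
        = ((T.cell k).normal j, (T.cell k).offset j) ∨
      ((T.cell l).normal m, (T.cell l).offset m) = (-(T.cell k).normal j, -(T.cell k).offset j)
  · exact ae_of_all _ fun _ _ _ => h
  · rw [not_or] at h
    have h0 := hausdorff_inter_hyperplanes ((T.cell k).norm_normal j) ((T.cell l).norm_normal m)
      h.1 h.2
    refine (measure_eq_zero_iff_ae_notMem.1 h0).mono fun x hx h1 h2 => (hx ⟨h1, h2⟩).elim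

variable {T}

theorem IsGeneric.facet_unique {x : EuclideanSpace ℝ (Fin d)} (hx : T.IsGeneric x) {k : Fin N}
    {j m : Fin (T.cell k).numFacets} (hj : x ∈ (T.cell k).facet j) (hm : x ∈ (T.cell k).facet m) :
    m = j := by
  rcases hx k j k m hj.2 hm.2 with h | h
  · exact (T.cell k).distinct h
  · exact ((T.cell k).not_opposite j m h).elim

/-- Near a generic interior point of a facet, the mesh consists of the two half-balls cut out by the
hyperplane of that facet: exactly one further cell touches the point, from the other side. -/
theorem IsGeneric.exists_neighbour (hΩ : IsOpen Ω) {x : EuclideanSpace ℝ (Fin d)}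
    (hx : T.IsGeneric x) (hxΩ : x ∈ Ω) {k : Fin N} {j : Fin (T.cell k).numFacets}
    (hj : x ∈ (T.cell k).facet j) :
    ∃ k' ≠ k, ∃ j' : Fin (T.cell k').numFacets, x ∈ (T.cell k').facet j' ∧
      (T.cell k').normal j' = -(T.cell k).normal j ∧
      ∀ l, x ∈ closure (T.cell l).carrier → l = k ∨ l = k' := by
  set n := (T.cell k).normal j with hn_def
  set c := (T.cell k).offset j with hc_def
  have hn : ‖n‖ = 1 := (T.cell k).norm_normal j
  have hnn : inner ℝ n n = (1 : ℝ) := by rw [real_inner_self_eq_norm_sq, hn, one_pow]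
  have hxc : inner ℝ n x = c := hj.2
  -- an open neighbourhood `U ⊆ Ω` on which strict inequalities at `x` persist
  have hev : ∀ᶠ z in 𝓝 x, z ∈ Ω ∧ ∀ l (m : Fin (T.cell l).numFacets),
      inner ℝ ((T.cell l).normal m) x < (T.cell l).offset m →
      inner ℝ ((T.cell l).normal m) z < (T.cell l).offset m := by
    have h0 : ∀ᶠ z in 𝓝 x, z ∈ Ω := hΩ.mem_nhds hxΩ
    refine h0.and (eventually_all.2 fun l => eventually_all.2 fun m =>
      eventually_all.2 fun h => ?_)
    exact (isOpen_lt (by fun_prop) continuous_const).mem_nhds h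
  have hev' : ∀ᶠ z in 𝓝 x, ∀ l (m : Fin (T.cell l).numFacets),
      (T.cell l).offset m < inner ℝ ((T.cell l).normal m) x →
      (T.cell l).offset m < inner ℝ ((T.cell l).normal m) z := by
    refine eventually_all.2 fun l => eventually_all.2 fun m => eventually_all.2 fun h => ?_
    exact (isOpen_lt continuous_const (by fun_prop)).mem_nhds h
  obtain ⟨U, hU, hUo, hxU⟩ := eventually_nhds_iff.1 (hev.and hev')
  -- on either side of the hyperplane, membership in a cell does not depend on the point of `U`
  let Am : Fin N → Prop := fun l => ∀ m : Fin (T.cell l).numFacets,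
    inner ℝ ((T.cell l).normal m) x < (T.cell l).offset m ∨
      ((T.cell l).normal m, (T.cell l).offset m) = (n, c)
  let Ap : Fin N → Prop := fun l => ∀ m : Fin (T.cell l).numFacets,
    inner ℝ ((T.cell l).normal m) x < (T.cell l).offset m ∨
      ((T.cell l).normal m, (T.cell l).offset m) = (-n, -c)
  have hm : ∀ l z, z ∈ U → inner ℝ n z < c → (z ∈ (T.cell l).carrier ↔ Am l) := by
    intro l z hz hzc
    refine forall_congr' fun m => ⟨fun h => ?_, fun h => ?_⟩
    · rcases lt_trichotomy (inner ℝ ((T.cell l).normal m) x) ((T.cell l).offset m) with h1 | h1 | h1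
      · exact Or.inl h1
      · rcases hx k j l m hxc h1 with h2 | h2
        · exact Or.inr h2
        · rw [Prod.mk.injEq] at h2
          rw [h2.1, h2.2, inner_neg_left] at h
          linarith
      · exact absurd h ((hU z hz).2 l m h1).not_gt
    · rcases h with h | h
      · exact (hU z hz).1.2 l m h
      · rw [Prod.mk.injEq] at h
        rwa [h.1, h.2]
  have hp : ∀ l z, z ∈ U → c < inner ℝ n z → (z ∈ (T.cell l).carrier ↔ Ap l) := by
    intro l z hz hzc
    refine forall_congr' fun m => ⟨fun h => ?_, fun h => ?_⟩
    · rcases lt_trichotomy (inner ℝ ((T.cell l).normal m) x) ((T.cell l).offset m) with h1 | h1 | h1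
      · exact Or.inl h1
      · rcases hx k j l m hxc h1 with h2 | h2
        · rw [Prod.mk.injEq] at h2
          rw [h2.1, h2.2] at h
          linarith
        · exact Or.inr h2
      · exact absurd h ((hU z hz).2 l m h1).not_gt
    · rcases h with h | h
      · exact (hU z hz).1.2 l m h
      · rw [Prod.mk.injEq] at h
        rw [h.1, h.2, inner_neg_left]
        linarith
  -- points of `U` near a given point, on a prescribed side
  have hshift : ∀ z (V : Set (EuclideanSpace ℝ (Fin d))), IsOpen V → z ∈ V →
      ∃ t > (0 : ℝ), z + t • n ∈ V ∧ z - t • n ∈ V := by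
    intro z V hV hz
    have h1 : Tendsto (fun t : ℝ => z + t • n) (𝓝[>] 0) (𝓝 z) := by
      have : Continuous fun t : ℝ => z + t • n := by fun_prop
      simpa using (this.tendsto 0).mono_left (nhdsWithin_le_nhds (s := Ioi 0))
    have h2 : Tendsto (fun t : ℝ => z - t • n) (𝓝[>] 0) (𝓝 z) := by
      have : Continuous fun t : ℝ => z - t • n := by fun_prop
      simpa using (this.tendsto 0).mono_left (nhdsWithin_le_nhds (s := Ioi 0))
    obtain ⟨t, ht, h3, h4⟩ := ((eventually_mem_nhdsWithin (a := (0 : ℝ)) (s := Ioi 0)).and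
      ((h1.eventually (hV.mem_nhds hz)).and (h2.eventually (hV.mem_nhds hz)))).exists
    exact ⟨t, ht, h3, h4⟩
  have hadd : ∀ z (t : ℝ), inner ℝ n (z + t • n) = inner ℝ n z + t := by
    intro z t; rw [inner_add_right, inner_smul_right, hnn, mul_one]
  have hsub : ∀ z (t : ℝ), inner ℝ n (z - t • n) = inner ℝ n z - t := by
    intro z t; rw [inner_sub_right, inner_smul_right, hnn, mul_one]
  obtain ⟨t₀, ht₀, hpU, hmU⟩ := hshift x U hUo hxU
  have hplt : c < inner ℝ n (x + t₀ • n) := by rw [hadd]; linarith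
  have hmlt : inner ℝ n (x - t₀ • n) < c := by rw [hsub]; linarith
  have hdisj : ∀ k l z, z ∈ (T.cell k).carrier → z ∈ (T.cell l).carrier → k = l := by
    intro k l z h1 h2
    by_contra h
    exact Set.disjoint_left.1 (T.disjoint h) h1 h2
  have hAm_unique : ∀ l l', Am l → Am l' → l = l' := fun l l' h h' =>
    hdisj _ _ _ ((hm l _ hmU hmlt).2 h) ((hm l' _ hmU hmlt).2 h')
  have hAp_unique : ∀ l l', Ap l → Ap l' → l = l' := fun l l' h h' =>
    hdisj _ _ _ ((hp l _ hpU hplt).2 h) ((hp l' _ hpU hplt).2 h')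
  have hAk : Am k := by
    obtain ⟨z, hzU, hz⟩ := mem_closure_iff.1 hj.1 U hUo hxU
    exact (hm k z hzU (hz j)).1 hz
  -- the cell on the other side
  obtain ⟨k', hk'⟩ := mem_iUnion.1 (T.cover (hU _ hpU).1.1)
  have hAk' : Ap k' := by
    obtain ⟨z, hzU, hz⟩ := mem_closure_iff.1 hk' (U ∩ {z | c < inner ℝ n z})
      (hUo.inter (isOpen_lt continuous_const (by fun_prop))) ⟨hpU, hplt⟩
    exact (hp k' z hzU.1 hzU.2).1 hz
  have hclo : x ∈ closure (T.cell k').carrier := by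
    rw [mem_closure_iff]
    intro V hV hxV
    obtain ⟨t, ht, h1, -⟩ := hshift x (U ∩ V) (hUo.inter hV) ⟨hxU, hxV⟩
    exact ⟨_, h1.2, (hp k' _ h1.1 (by rw [hadd]; linarith)).2 hAk'⟩
  have hne : k' ≠ k := by
    rintro rfl
    rcases hAk' j with h | h
    · exact absurd hxc h.ne
    · exact (T.cell k').not_opposite j j h
  obtain ⟨j', hj'⟩ : ∃ j', ¬ inner ℝ ((T.cell k').normal j') x < (T.cell k').offset j' := by
    by_contra! h
    exact hne (hAm_unique _ _ (fun m => Or.inl (h m)) hAk)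
  have hopp := (hAk' j').resolve_left hj'
  refine ⟨k', hne, j', ⟨hclo, le_antisymm ((T.cell k').inner_le_of_mem_closure hclo j')
    (not_lt.1 hj')⟩, (Prod.mk.inj hopp).1, fun l hl => ?_⟩
  obtain ⟨z, hzU, hz⟩ := mem_closure_iff.1 hl U hUo hxU
  obtain ⟨t, ht, -, h2⟩ := hshift z (U ∩ (T.cell l).carrier)
    (hUo.inter (T.cell l).isOpen_carrier) ⟨hzU, hz⟩
  rcases le_or_gt (inner ℝ n z) c with h | h
  · exact Or.inl (hAm_unique _ _ ((hm l _ h2.1 (by rw [hsub]; linarith)).1 h2.2) hAk)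
  · exact Or.inr (hAp_unique _ _ ((hp l _ hzU h).1 hz) hAk')

end Mesh
end DGCalculus

/-! ### Restriction of weak derivatives and absence of jumps -/

namespace DGCalculus

theorem IsWeakPartial.mono {d : ℕ} {U V : Set (EuclideanSpace ℝ (Fin d))} {i : Fin d}
    {v g : EuclideanSpace ℝ (Fin d) → ℝ} (h : IsWeakPartial V i v g) (hUV : U ⊆ V) :
    IsWeakPartial U i v g := by
  refine ⟨h.1.mono_set hUV, h.2.1.mono_set hUV, fun φ hφ hc hs => ?_⟩
  have h1 := h.2.2 φ hφ hc (hs.trans hUV)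
  have h0 : ∀ x ∉ U, φ x = 0 := fun x hx => image_eq_zero_of_notMem_tsupport fun h' => hx (hs h')
  have h0' : ∀ x ∉ U, fderiv ℝ φ x = 0 := fun x hx =>
    image_eq_zero_of_notMem_tsupport fun h' => hx (hs (tsupport_fderiv_subset ℝ h'))
  have key : ∀ F : EuclideanSpace ℝ (Fin d) → ℝ, (∀ x ∉ U, F x = 0) →
      ∫ x in V, F x = ∫ x in U, F x := fun F hF => by
    rw [setIntegral_eq_integral_of_forall_compl_eq_zero fun x hx => hF x fun h => hx (hUV h),
      setIntegral_eq_integral_of_forall_compl_eq_zero hF]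
  rw [key _ fun x hx => by rw [h0' x hx]; simp, key _ fun x hx => by rw [h0 x hx, mul_zero]] at h1
  exact h1

theorem Polytope.convex_carrier {d : ℕ} (K : Polytope d) : Convex ℝ K.carrier := by
  simp only [Polytope.carrier, Set.ofPred_forall]
  exact convex_iInter fun j => convex_halfSpace_lt (innerSL ℝ (K.normal j)).isLinear _

namespace Mesh

variable {d N : ℕ} {Ω : Set (EuclideanSpace ℝ (Fin d))} {T : Mesh d Ω N}

/-- The skeleton of the mesh is a null set: the boundary of a convex set is. -/
theorem ae_eq_iUnion_cells (T : Mesh d Ω N) :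
    Ω =ᵐ[volume] (⋃ k, (T.cell k).carrier : Set (EuclideanSpace ℝ (Fin d))) := by
  have h0 : volume (⋃ k, frontier (T.cell k).carrier) = 0 :=
    measure_iUnion_null fun k => (T.cell k).convex_carrier.addHaar_frontier volume
  filter_upwards [measure_eq_zero_iff_ae_notMem.1 h0] with x hx
  refine propext ⟨fun h => ?_, fun h => iUnion_subset T.cell_subset h⟩
  obtain ⟨k, hk⟩ := mem_iUnion.1 (T.cover h)
  by_contra hn
  refine hx (mem_iUnion.2 ⟨k, hk, ?_⟩)
  rw [(T.cell k).isOpen_carrier.interior_eq]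
  exact fun h' => hn (mem_iUnion.2 ⟨k, h'⟩)

theorem setIntegral_eq_sum_cells (T : Mesh d Ω N) {h : EuclideanSpace ℝ (Fin d) → ℝ}
    (hh : ∀ k, IntegrableOn h (T.cell k).carrier) :
    ∫ x in Ω, h x = ∑ k, ∫ x in (T.cell k).carrier, h x := by
  rw [setIntegral_congr_set T.ae_eq_iUnion_cells,
    integral_iUnion_fintype (fun k => (T.cell k).isOpen_carrier.measurableSet) T.disjoint hh]

theorem trace_eqOn_closure {v f : EuclideanSpace ℝ (Fin d) → ℝ} {k : Fin N}
    (hf : ContinuousOn f (closure (T.cell k).carrier)) (hvf : EqOn v f (T.cell k).carrier) :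
    EqOn ((T.cell k).trace v) f (closure (T.cell k).carrier) := by
  intro x hx
  refine extendFrom_eq hx ?_
  exact ((hf x hx).mono_left (nhdsWithin_mono _ subset_closure)).congr'
    (eventually_mem_nhdsWithin.mono fun y hy => (hvf hy).symm)

theorem MemBrokenC0.continuousOn_trace {v : EuclideanSpace ℝ (Fin d) → ℝ} (hv : T.MemBrokenC0 v)
    (k : Fin N) : ContinuousOn ((T.cell k).trace v) (closure (T.cell k).carrier) := by
  obtain ⟨f, hf, hvf⟩ := hv k
  exact hf.congr (trace_eqOn_closure hf hvf)

theorem MemBrokenC0.eqOn_trace {v : EuclideanSpace ℝ (Fin d) → ℝ} (hv : T.MemBrokenC0 v)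
    (k : Fin N) : EqOn v ((T.cell k).trace v) (T.cell k).carrier := by
  obtain ⟨f, hf, hvf⟩ := hv k
  exact fun x hx => (hvf hx).trans (trace_eqOn_closure hf hvf (subset_closure hx)).symm

/-- Exactly two facets of the mesh pass through `x`: the facet `j` of the cell `k` and, with the
opposite normal, the facet `j'` of the cell `k'`; no further cell touches `x`. -/
structure IsFacePair (T : Mesh d Ω N) (x : EuclideanSpace ℝ (Fin d))
    (k : Fin N) (j : Fin (T.cell k).numFacets) (k' : Fin N) (j' : Fin (T.cell k').numFacets) :
    Prop where
  ne : k ≠ k'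
  mem : x ∈ (T.cell k).facet j
  mem' : x ∈ (T.cell k').facet j'
  normal_eq : (T.cell k').normal j' = -(T.cell k).normal j
  eq_or_eq : ∀ l, x ∈ closure (T.cell l).carrier → l = k ∨ l = k'
  unique : ∀ m, x ∈ (T.cell k).facet m → m = j
  unique' : ∀ m, x ∈ (T.cell k').facet m → m = j'

theorem IsGeneric.exists_isFacePair (hΩ : IsOpen Ω) {x : EuclideanSpace ℝ (Fin d)}
    (hx : T.IsGeneric x) (hxΩ : x ∈ Ω) {k : Fin N} {j : Fin (T.cell k).numFacets}
    (hj : x ∈ (T.cell k).facet j) : ∃ k' j', T.IsFacePair x k j k' j' := by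
  obtain ⟨k', hne, j', hj', hn, h⟩ := hx.exists_neighbour hΩ hxΩ hj
  exact ⟨k', j', hne.symm, hj, hj', hn, h, fun m hm => hx.facet_unique hj hm,
    fun m hm => hx.facet_unique hj' hm⟩

variable {x : EuclideanSpace ℝ (Fin d)} {k k' : Fin N} {j : Fin (T.cell k).numFacets}
  {j' : Fin (T.cell k').numFacets}

theorem IsFacePair.symm (h : T.IsFacePair x k j k' j') : T.IsFacePair x k' j' k j :=
  ⟨h.ne.symm, h.mem', h.mem, by rw [h.normal_eq, neg_neg], fun l hl => (h.eq_or_eq l hl).symm,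
    h.unique', h.unique⟩

theorem IsFacePair.sum_facets (h : T.IsFacePair x k j k' j')
    (a : ∀ l, Fin (T.cell l).numFacets → EuclideanSpace ℝ (Fin d) → ℝ) :
    ∑ l, ∑ m, ((T.cell l).facet m).indicator (a l m) x = a k j x + a k' j' x := by
  rw [Finset.sum_eq_add k k' h.ne, Finset.sum_eq_single j, Finset.sum_eq_single j',
    indicator_of_mem h.mem, indicator_of_mem h.mem']
  · exact fun m _ hm => indicator_of_notMem (fun h' => hm (h.unique' m h')) _
  · simp
  · exact fun m _ hm => indicator_of_notMem (fun h' => hm (h.unique m h')) _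
  · simp
  · rintro l - ⟨h1, h2⟩
    refine Finset.sum_eq_zero fun m _ => indicator_of_notMem (fun h' => ?_) _
    exact (h.eq_or_eq l h'.1).elim h1 h2
  · simp
  · simp

/-- Of the ordered pairs of cells that index the interior faces, only `k < k'` contributes at `x`. -/
theorem IsFacePair.sum_interiorFaces (h : T.IsFacePair x k j k' j') (hxΩ : x ∈ Ω) (hlt : k < k')
    (a : ∀ l, Fin N → Fin (T.cell l).numFacets → EuclideanSpace ℝ (Fin d) → ℝ) :
    ∑ l, ∑ l' ∈ Finset.Ioi l, ∑ m, (T.interiorFace l m l').indicator (a l l' m) x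
      = a k k' j x := by
  have hx : x ∈ T.interiorFace k j k' := ⟨⟨h.mem, h.mem'.1⟩, hxΩ⟩
  rw [Finset.sum_eq_single k, Finset.sum_eq_single k', Finset.sum_eq_single j,
    indicator_of_mem hx]
  · exact fun m _ hm => indicator_of_notMem (fun h' => hm (h.unique m h'.1.1)) _
  · simp
  · intro l' hl' hne
    refine Finset.sum_eq_zero fun m _ => indicator_of_notMem (fun h' => ?_) _
    rcases h.eq_or_eq l' h'.1.2 with rfl | rfl
    · exact absurd (Finset.mem_Ioi.1 hl') (lt_irrefl _)
    · exact hne rfl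
  · exact fun h' => absurd (Finset.mem_Ioi.2 hlt) h'
  · intro l _ hne
    refine Finset.sum_eq_zero fun l' hl' => Finset.sum_eq_zero fun m _ =>
      indicator_of_notMem (fun h' => ?_) _
    rw [Finset.mem_Ioi] at hl'
    rcases h.eq_or_eq l h'.1.1.1 with rfl | rfl
    · exact hne rfl
    · rcases h.eq_or_eq l' h'.1.2 with rfl | rfl
      · exact absurd hl' hlt.not_gt
      · exact lt_irrefl _ hl'
  · simp

/-- The sum over all facets through `x` of the traces of `v`, weighted with the `m`-th component
of the outward normal: on a face shared by two cells, the jump of `v` times that component. -/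
noncomputable def normalJump (T : Mesh d Ω N) (v : EuclideanSpace ℝ (Fin d) → ℝ) (m : Fin d)
    (x : EuclideanSpace ℝ (Fin d)) : ℝ :=
  ∑ k, ∑ j, ((T.cell k).facet j).indicator
    (fun x => (T.cell k).trace v x * (T.cell k).normal j m) x

theorem integral_sum_facets (T : Mesh d Ω N)
    {a : ∀ l, Fin (T.cell l).numFacets → EuclideanSpace ℝ (Fin d) → ℝ}
    (ha : ∀ k j, ContinuousOn (a k j) (closure (T.cell k).carrier)) :
    Integrable (fun x => ∑ k, ∑ j, ((T.cell k).facet j).indicator (a k j) x)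
      (Measure.euclideanHausdorffMeasure (d - 1)) ∧
    ∫ x, ∑ k, ∑ j, ((T.cell k).facet j).indicator (a k j) x
        ∂(Measure.euclideanHausdorffMeasure (d - 1))
      = ∑ k, ∑ j, ∫ x in (T.cell k).facet j, a k j x
        ∂(Measure.euclideanHausdorffMeasure (d - 1)) := by
  have hint : ∀ k j, Integrable (((T.cell k).facet j).indicator (a k j))
      (Measure.euclideanHausdorffMeasure (d - 1)) := fun k j =>
    (integrable_indicator_iff ((T.cell k).isCompact_facet j).measurableSet).2
      ((T.cell k).integrableOn_of_subset_facet (T.cell k).isCompact_closure (ha k j)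
        ((T.cell k).isCompact_facet j).measurableSet ((T.cell k).facet_subset_closure j)
        Subset.rfl)
  refine ⟨integrable_finsetSum _ fun k _ => integrable_finsetSum _ fun j _ => hint k j, ?_⟩
  rw [integral_finsetSum _ fun k _ => integrable_finsetSum _ fun j _ => hint k j]
  refine Finset.sum_congr rfl fun k _ => ?_
  rw [integral_finsetSum _ fun j _ => hint k j]
  exact Finset.sum_congr rfl fun j _ =>
    integral_indicator ((T.cell k).isCompact_facet j).measurableSet

/-- A function of class `H¹(Ω)` does not jump across the interior faces: testing Green's formula
on all cells with functions supported in `Ω` shows that the normal jump is orthogonal, with respect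
to surface measure, to all test functions. -/
theorem ae_normalJump_eq_zero (hΩ : IsOpen Ω) {v g : EuclideanSpace ℝ (Fin d) → ℝ}
    (hv : T.MemBrokenC0 v) {m : Fin d} (hg : IsWeakPartial Ω m v g) (hgi : IntegrableOn g Ω) :
    ∀ᵐ x ∂(Measure.euclideanHausdorffMeasure (d - 1) : Measure (EuclideanSpace ℝ (Fin d))),
      x ∈ Ω → T.normalJump v m x = 0 := by
  have hF := T.integral_sum_facets (a := fun k j x => (T.cell k).trace v x * (T.cell k).normal j m)
    fun k j => (hv.continuousOn_trace k).mul continuousOn_const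
  refine hΩ.ae_eq_zero_of_integral_contDiff_smul_eq_zero
    (hF.1.locallyIntegrable.locallyIntegrableOn _) fun φ hφ hc hs => ?_
  have hG : ∀ k, _ := fun k => (T.cell k).integral_weakPartial_mul (hv.continuousOn_trace k)
    (hv.eqOn_trace k) (hg.mono (T.cell_subset k)) (hgi.mono_set (T.cell_subset k)) hφ
  have hdφ : Continuous fun x => fderiv ℝ φ x (EuclideanSpace.single m 1) :=
    (hφ.continuous_fderiv (by simp)).clm_apply continuous_const
  have h1 : ∫ x in Ω, v x * fderiv ℝ φ x (EuclideanSpace.single m 1)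
      = ∑ k, ∫ x in (T.cell k).carrier, v x * fderiv ℝ φ x (EuclideanSpace.single m 1) := by
    refine T.setIntegral_eq_sum_cells fun k => ?_
    have : ContinuousOn (fun x => (T.cell k).trace v x * fderiv ℝ φ x (EuclideanSpace.single m 1))
        (closure (T.cell k).carrier) := (hv.continuousOn_trace k).mul hdφ.continuousOn
    refine ((this.integrableOn_compact (T.cell k).isCompact_closure).mono_set
      subset_closure).congr_fun (fun x hx => ?_) (T.cell k).isOpen_carrier.measurableSet
    simp only [hv.eqOn_trace k hx]
  have h2 : ∫ x in Ω, g x * φ x = ∑ k, ∫ x in (T.cell k).carrier, g x * φ x := by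
    obtain ⟨C, hC⟩ := hφ.continuous.bounded_above_of_compact_support hc
    exact T.setIntegral_eq_sum_cells fun k => (hgi.mono_set (T.cell_subset k)).mul_bdd
      (c := C) hφ.continuous.aestronglyMeasurable (ae_of_all _ hC)
  have h3 := hg.2.2 φ hφ hc hs
  rw [h1, h2, Finset.sum_congr rfl fun k _ => hG k, Finset.sum_add_distrib,
    Finset.sum_neg_distrib] at h3
  have h4 := (T.integral_sum_facets
    (a := fun k j x => (T.cell k).trace v x * (T.cell k).normal j m * φ x)
    fun k j => ((hv.continuousOn_trace k).mul continuousOn_const).mul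
      hφ.continuous.continuousOn).2
  have h5 : ∀ x, φ x • T.normalJump v m x = ∑ k, ∑ j, ((T.cell k).facet j).indicator
      (fun x => (T.cell k).trace v x * (T.cell k).normal j m * φ x) x := by
    intro x
    simp only [normalJump, smul_eq_mul, Finset.mul_sum]
    refine Finset.sum_congr rfl fun k _ => Finset.sum_congr rfl fun j _ => ?_
    by_cases hx : x ∈ (T.cell k).facet j
    · simp only [indicator_of_mem hx]; ring
    · simp only [indicator_of_notMem hx, mul_zero]
  change ∫ x, φ x • T.normalJump v m x ∂_ = 0
  simp only [h5]
  rw [h4]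
  linarith

/-- A unit normal has a nonzero component, so the vanishing of all normal jumps forces the two traces
to agree. -/
theorem IsFacePair.trace_eq (h : T.IsFacePair x k j k' j') {v : EuclideanSpace ℝ (Fin d) → ℝ}
    (hJ : ∀ m, T.normalJump v m x = 0) : (T.cell k).trace v x = (T.cell k').trace v x := by
  have hn : (T.cell k).normal j ≠ 0 := by
    intro h0
    have := (T.cell k).norm_normal j
    rw [h0, norm_zero] at this
    exact zero_ne_one this
  obtain ⟨m, hm⟩ : ∃ m, (T.cell k).normal j m ≠ 0 := by
    by_contra! h0
    exact hn (by ext m; simpa using h0 m)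
  have h1 := hJ m
  rw [normalJump, h.sum_facets (fun k j x => (T.cell k).trace v x * (T.cell k).normal j m),
    h.normal_eq, PiLp.neg_apply] at h1
  have h2 : ((T.cell k).trace v x - (T.cell k').trace v x) * (T.cell k).normal j m = 0 := by
    linarith
  exact sub_eq_zero.1 ((mul_eq_zero.1 h2).resolve_right hm)

end Mesh
end DGCalculus

/-! ### Polynomials and the consistency identity -/

namespace DGCalculus

theorem contDiff_polyEval {d : ℕ} (p : MvPolynomial (Fin d) ℝ) :
    ContDiff ℝ ∞ (polyEval p) := by
  induction p using MvPolynomial.induction_on with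
  | C a =>
    have : polyEval (d := d) (MvPolynomial.C a) = fun _ => a := by funext; simp [polyEval]
    rw [this]
    exact contDiff_const
  | add p q hp hq =>
    have : polyEval (p + q) = fun x => polyEval p x + polyEval q x := by funext; simp [polyEval]
    rw [this]
    exact hp.add hq
  | mul_X p j hp =>
    have : polyEval (p * MvPolynomial.X j) = fun x => polyEval p x * x j := by
      funext; simp [polyEval]
    rw [this]
    exact hp.mul (by fun_prop)

theorem fderiv_polyEval {d : ℕ} (p : MvPolynomial (Fin d) ℝ) (i : Fin d)
    (x : EuclideanSpace ℝ (Fin d)) :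
    fderiv ℝ (polyEval p) x (EuclideanSpace.single i 1)
      = polyEval (MvPolynomial.pderiv i p) x := by
  have hd : ∀ q : MvPolynomial (Fin d) ℝ, DifferentiableAt ℝ (polyEval q) x := fun q =>
    (contDiff_polyEval q).differentiable (by simp) x
  induction p using MvPolynomial.induction_on with
  | C a =>
    have : polyEval (d := d) (MvPolynomial.C a) = fun _ => a := by funext; simp [polyEval]
    rw [this]
    simp [polyEval]
  | add p q hp hq =>
    have : polyEval (p + q) = fun x => polyEval p x + polyEval q x := by funext; simp [polyEval]
    rw [this, fderiv_fun_add (hd p) (hd q), add_apply, hp, hq]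
    simp [polyEval]
  | mul_X p j hp =>
    have : polyEval (p * MvPolynomial.X j) = fun x => polyEval p x * x j := by
      funext; simp [polyEval]
    have hj : HasFDerivAt (fun x : EuclideanSpace ℝ (Fin d) => x j)
        (EuclideanSpace.proj j : EuclideanSpace ℝ (Fin d) →L[ℝ] ℝ) x :=
      (EuclideanSpace.proj j : EuclideanSpace ℝ (Fin d) →L[ℝ] ℝ).hasFDerivAt
    rw [this, fderiv_fun_mul (hd p) hj.differentiableAt, hj.fderiv, add_apply, smul_apply,
      smul_apply, hp, Derivation.leibniz, MvPolynomial.pderiv_X]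
    by_cases h : i = j
    · subst h
      simp [polyEval]
    · simp [polyEval, Ne.symm h]

namespace Mesh

variable {d N : ℕ} {Ω : Set (EuclideanSpace ℝ (Fin d))} {T : Mesh d Ω N}

theorem measurableSet_interiorFace (hΩ : IsOpen Ω) (k k' : Fin N)
    (j : Fin (T.cell k).numFacets) : MeasurableSet (T.interiorFace k j k') :=
  (((T.cell k).isCompact_facet j).measurableSet.inter isClosed_closure.measurableSet).inter
    hΩ.measurableSet

theorem integral_sum_interiorFaces (hΩ : IsOpen Ω)
    {a : ∀ l, Fin N → Fin (T.cell l).numFacets → EuclideanSpace ℝ (Fin d) → ℝ}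
    (ha : ∀ k k' j, ContinuousOn (a k k' j)
      (closure (T.cell k).carrier ∩ closure (T.cell k').carrier)) :
    Integrable (fun x => ∑ k, ∑ k' ∈ Finset.Ioi k, ∑ j,
        (T.interiorFace k j k').indicator (a k k' j) x)
      (Measure.euclideanHausdorffMeasure (d - 1)) ∧
    ∫ x, ∑ k, ∑ k' ∈ Finset.Ioi k, ∑ j, (T.interiorFace k j k').indicator (a k k' j) x
        ∂(Measure.euclideanHausdorffMeasure (d - 1))
      = ∑ k, ∑ k' ∈ Finset.Ioi k, ∑ j, ∫ x in T.interiorFace k j k', a k k' j x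
        ∂(Measure.euclideanHausdorffMeasure (d - 1)) := by
  have hint : ∀ k k' j, Integrable ((T.interiorFace k j k').indicator (a k k' j))
      (Measure.euclideanHausdorffMeasure (d - 1)) := fun k k' j =>
    (integrable_indicator_iff (measurableSet_interiorFace hΩ k k' j)).2
      ((T.cell k).integrableOn_of_subset_facet
        ((T.cell k).isCompact_closure.inter (T.cell k').isCompact_closure) (ha k k' j)
        (measurableSet_interiorFace hΩ k k' j)
        (fun x hx => ⟨hx.1.1.1, hx.1.2⟩) (fun x hx => hx.1.1))
  refine ⟨integrable_finsetSum _ fun k _ => integrable_finsetSum _ fun k' _ =>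
    integrable_finsetSum _ fun j _ => hint k k' j, ?_⟩
  rw [integral_finsetSum _ fun k _ => integrable_finsetSum _ fun k' _ =>
    integrable_finsetSum _ fun j _ => hint k k' j]
  refine Finset.sum_congr rfl fun k _ => ?_
  rw [integral_finsetSum _ fun k' _ => integrable_finsetSum _ fun j _ => hint k k' j]
  refine Finset.sum_congr rfl fun k' _ => ?_
  rw [integral_finsetSum _ fun j _ => hint k k' j]
  exact Finset.sum_congr rfl fun j _ => integral_indicator (measurableSet_interiorFace hΩ k k' j)

theorem integral_sum_boundaryFaces
    {a : ∀ l, Fin (T.cell l).numFacets → EuclideanSpace ℝ (Fin d) → ℝ}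
    (ha : ∀ k j, ContinuousOn (a k j) (closure (T.cell k).carrier)) :
    Integrable (fun x => ∑ k, ∑ j, (T.boundaryFace k j).indicator (a k j) x)
      (Measure.euclideanHausdorffMeasure (d - 1)) ∧
    ∫ x, ∑ k, ∑ j, (T.boundaryFace k j).indicator (a k j) x
        ∂(Measure.euclideanHausdorffMeasure (d - 1))
      = ∑ k, ∑ j, ∫ x in T.boundaryFace k j, a k j x
        ∂(Measure.euclideanHausdorffMeasure (d - 1)) := by
  have hm : ∀ k j, MeasurableSet (T.boundaryFace k j) := fun k j =>
    ((T.cell k).isCompact_facet j).measurableSet.inter isClosed_frontier.measurableSet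
  have hint : ∀ k j, Integrable ((T.boundaryFace k j).indicator (a k j))
      (Measure.euclideanHausdorffMeasure (d - 1)) := fun k j =>
    (integrable_indicator_iff (hm k j)).2
      ((T.cell k).integrableOn_of_subset_facet (T.cell k).isCompact_closure (ha k j)
        (hm k j) (fun x hx => hx.1.1) (fun x hx => hx.1))
  refine ⟨integrable_finsetSum _ fun k _ => integrable_finsetSum _ fun j _ => hint k j, ?_⟩
  rw [integral_finsetSum _ fun k _ => integrable_finsetSum _ fun j _ => hint k j]
  refine Finset.sum_congr rfl fun k _ => ?_
  rw [integral_finsetSum _ fun j _ => hint k j]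
  exact Finset.sum_congr rfl fun j _ => integral_indicator (hm k j)

theorem MemBrokenC0.continuousOn_traceQ {v : EuclideanSpace ℝ (Fin d) → ℝ} (hv : T.MemBrokenC0 v)
    (s : Side) (k k' : Fin N) (ν : ℝ) : ContinuousOn (T.traceQ s v k k' ν)
      (closure (T.cell k).carrier ∩ closure (T.cell k').carrier) := by
  have h1 := (hv.continuousOn_trace k).mono
    (inter_subset_left (t := closure (T.cell k').carrier))
  have h2 := (hv.continuousOn_trace k').mono
    (inter_subset_right (s := closure (T.cell k).carrier))
  unfold traceQ
  cases s <;> by_cases h : ν < 0 <;> simp only [h, if_true, if_false] <;> assumption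

theorem traceQ_eq_of_trace_eq {v : EuclideanSpace ℝ (Fin d) → ℝ} {k k' : Fin N}
    {x : EuclideanSpace ℝ (Fin d)} (h : (T.cell k).trace v x = (T.cell k').trace v x)
    (s : Side) (ν : ℝ) : T.traceQ s v k k' ν x = (T.cell k).trace v x := by
  unfold traceQ
  cases s <;> simp only [h, ite_self]

/-- For `v` without jumps, the sum of the numerical fluxes over all faces is, pointwise, the sum
over all cells of the fluxes through their facets. -/
theorem sum_fluxes_eq (hΩ : IsOpen Ω) {v : EuclideanSpace ℝ (Fin d) → ℝ} (s : Side) (i : Fin d)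
    (w : Fin N → EuclideanSpace ℝ (Fin d) → ℝ) {x : EuclideanSpace ℝ (Fin d)}
    (hx : T.IsGeneric x) (hJ : x ∈ Ω → ∀ m, T.normalJump v m x = 0) :
    (∑ k, ∑ k' ∈ Finset.Ioi k, ∑ j, (T.interiorFace k j k').indicator (fun x =>
        T.traceQ s v k k' ((T.cell k).normal j i) x * (T.cell k).normal j i * (w k x - w k' x)) x)
      + ∑ k, ∑ j, (T.boundaryFace k j).indicator (fun x =>
        (T.cell k).trace v x * (T.cell k).normal j i * w k x) x
      = ∑ k, ∑ j, ((T.cell k).facet j).indicator (fun x =>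
        (T.cell k).trace v x * (T.cell k).normal j i * w k x) x := by
  by_cases hxΩ : x ∈ Ω
  · have hb : ∀ k j, x ∉ T.boundaryFace k j := fun k j h => by
      have := h.2.2
      rw [hΩ.interior_eq] at this
      exact this hxΩ
    simp only [indicator_of_notMem (hb _ _), Finset.sum_const_zero, add_zero]
    by_cases hF : ∃ k j, x ∈ (T.cell k).facet j
    · obtain ⟨k, j, k', j', hP, hlt⟩ : ∃ k j k' j', T.IsFacePair x k j k' j' ∧ k < k' := by
        obtain ⟨k, j, hj⟩ := hF
        obtain ⟨k', j', hP⟩ := hx.exists_isFacePair hΩ hxΩ hj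
        rcases lt_or_gt_of_ne hP.ne with h | h
        · exact ⟨k, j, k', j', hP, h⟩
        · exact ⟨k', j', k, j, hP.symm, h⟩
      have htr := hP.trace_eq (hJ hxΩ)
      rw [hP.sum_interiorFaces hxΩ hlt (fun k k' j x => T.traceQ s v k k' ((T.cell k).normal j i) x
          * (T.cell k).normal j i * (w k x - w k' x)),
        hP.sum_facets (fun k j x => (T.cell k).trace v x * (T.cell k).normal j i * w k x),
        traceQ_eq_of_trace_eq htr, hP.normal_eq, PiLp.neg_apply, ← htr]
      ring
    · push Not at hF
      rw [Finset.sum_eq_zero fun k _ => Finset.sum_eq_zero fun k' _ => Finset.sum_eq_zero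
        fun j _ => indicator_of_notMem (fun h => hF k j h.1.1) _,
        Finset.sum_eq_zero fun k _ => Finset.sum_eq_zero
        fun j _ => indicator_of_notMem (hF k j) _]
  · rw [Finset.sum_eq_zero fun k _ => Finset.sum_eq_zero fun k' _ => Finset.sum_eq_zero
        fun j _ => indicator_of_notMem (fun h => hxΩ h.2) _, zero_add]
    refine Finset.sum_congr rfl fun k _ => Finset.sum_congr rfl fun j _ => ?_
    by_cases hj : x ∈ (T.cell k).facet j
    · have hb : x ∈ T.boundaryFace k j :=
        ⟨hj, closure_mono (T.cell_subset k) hj.1, by rwa [hΩ.interior_eq]⟩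
      rw [indicator_of_mem hj, indicator_of_mem hb]
    · rw [indicator_of_notMem hj, indicator_of_notMem fun h => hj h.1]

/-- For `v ∈ H¹(Ω)` the discrete derivatives are tested like the weak derivative. -/
theorem derivFunctional_eq (hΩ : IsOpen Ω) {r : ℕ} {i : Fin d} (s : Side)
    (γ : Fin N → Fin N → ℝ) {v g : EuclideanSpace ℝ (Fin d) → ℝ} (hv : T.MemBrokenC0 v)
    (hg : IsWeakPartial Ω i v g) (hgi : IntegrableOn g Ω)
    (hw : ∀ m, ∃ w, IsWeakPartial Ω m v w ∧ IntegrableOn w Ω) (φ : DGSpace d N r) :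
    T.derivFunctional i s γ v φ
      = ∑ k, ∫ x in (T.cell k).carrier, g x * polyEval (φ k) x := by
  have hJ : ∀ᵐ x ∂(Measure.euclideanHausdorffMeasure (d - 1) :
      Measure (EuclideanSpace ℝ (Fin d))), x ∈ Ω → ∀ m, T.normalJump v m x = 0 := by
    have : ∀ᵐ x ∂(Measure.euclideanHausdorffMeasure (d - 1) :
        Measure (EuclideanSpace ℝ (Fin d))), ∀ m, x ∈ Ω → T.normalJump v m x = 0 :=
      ae_all_iff.2 fun m => by
        obtain ⟨w, hw1, hw2⟩ := hw m
        exact ae_normalJump_eq_zero hΩ hv hw1 hw2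
    exact this.mono fun x hx hxΩ m => hx m hxΩ
  have hcφ : ∀ k, Continuous (polyEval (φ k : MvPolynomial (Fin d) ℝ)) := fun k =>
    (contDiff_polyEval _).continuous
  -- the penalty term vanishes, since `v` does not jump
  have hpen : ∀ k, ∀ k' ∈ Finset.Ioi k, ∀ j, ∫ x in T.interiorFace k j k',
      γ k k' * T.jump v k k' x * (polyEval (φ k) x - polyEval (φ k') x)
        ∂(Measure.euclideanHausdorffMeasure (d - 1)) = 0 := by
    intro k k' hk' j
    refine setIntegral_eq_zero_of_ae_eq_zero ?_
    filter_upwards [hJ, T.ae_isGeneric] with x h1 h2 hx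
    obtain ⟨l, m, hP⟩ := h2.exists_isFacePair hΩ hx.2 hx.1.1
    have hl : k' = l := (hP.eq_or_eq k' hx.1.2).resolve_left (Finset.mem_Ioi.1 hk').ne'
    subst hl
    rw [jump, hP.trace_eq (h1 hx.2), sub_self, mul_zero, zero_mul]
  have hGreen := fun k => (T.cell k).integral_weakPartial_mul (hv.continuousOn_trace k)
    (hv.eqOn_trace k) (hg.mono (T.cell_subset k)) (hgi.mono_set (T.cell_subset k))
    (contDiff_polyEval (φ k : MvPolynomial (Fin d) ℝ))
  have hI := integral_sum_interiorFaces (T := T) hΩ (a := fun k k' j x =>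
      T.traceQ s v k k' ((T.cell k).normal j i) x * (T.cell k).normal j i *
        (polyEval (φ k) x - polyEval (φ k') x)) fun k k' j =>
    ((hv.continuousOn_traceQ s k k' _).mul continuousOn_const).mul
      ((hcφ k).sub (hcφ k')).continuousOn
  have hB := integral_sum_boundaryFaces (T := T) (a := fun k j x =>
      (T.cell k).trace v x * (T.cell k).normal j i * polyEval (φ k) x) fun k j =>
    ((hv.continuousOn_trace k).mul continuousOn_const).mul (hcφ k).continuousOn
  have hF := T.integral_sum_facets (a := fun k j x =>
      (T.cell k).trace v x * (T.cell k).normal j i * polyEval (φ k) x) fun k j =>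
    ((hv.continuousOn_trace k).mul continuousOn_const).mul (hcφ k).continuousOn
  have hflux := hF.2
  rw [← integral_congr_ae (T.ae_isGeneric.mp (hJ.mono fun x h1 h2 =>
    sum_fluxes_eq hΩ s i (fun k => polyEval (φ k : MvPolynomial (Fin d) ℝ)) h2 h1)),
    integral_add hI.1 hB.1, hI.2, hB.2] at hflux
  unfold derivFunctional
  rw [hflux, Finset.sum_eq_zero fun k _ => Finset.sum_eq_zero fun k' hk' =>
    Finset.sum_eq_zero fun j _ => hpen k k' hk' j, Finset.sum_congr rfl fun k _ => hGreen k,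
    Finset.sum_add_distrib, Finset.sum_neg_distrib]
  simp only [fderiv_polyEval]
  ring

end Mesh
end DGCalculus

/-! ### The `L²` projection onto piecewise polynomials -/

namespace DGCalculus

theorem integrable_smul_of_tsupport_subset {d : ℕ} {U : Set (EuclideanSpace ℝ (Fin d))}
    {g φ : EuclideanSpace ℝ (Fin d) → ℝ} (hg : LocallyIntegrableOn g U) (hφ : Continuous φ)
    (hc : HasCompactSupport φ) (hs : tsupport φ ⊆ U) : Integrable fun x => φ x • g x := by
  have h1 : IntegrableOn g (tsupport φ) := hg.integrableOn_compact_subset hs hc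
  obtain ⟨C, hC⟩ := hφ.bounded_above_of_compact_support hc
  have h2 : IntegrableOn (fun x => φ x • g x) (tsupport φ) :=
    Integrable.bdd_mul (c := C) h1 hφ.aestronglyMeasurable (ae_of_all _ hC)
  refine (integrableOn_iff_integrable_of_support_subset fun x hx => ?_).1 h2
  refine subset_tsupport φ fun h => hx ?_
  simp [h]

/-- Weak derivatives are unique up to null sets. -/
theorem IsWeakPartial.ae_eq {d : ℕ} {U : Set (EuclideanSpace ℝ (Fin d))} (hU : IsOpen U)
    {i : Fin d} {v g w : EuclideanSpace ℝ (Fin d) → ℝ} (hg : IsWeakPartial U i v g)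
    (hw : IsWeakPartial U i v w) : g =ᵐ[volume.restrict U] w := by
  have h := hU.ae_eq_zero_of_integral_contDiff_smul_eq_zero (hg.2.1.sub hw.2.1) (μ := volume)
    fun φ hφ hc hs => by
      have h1 := integrable_smul_of_tsupport_subset hg.2.1 hφ.continuous hc hs
      have h2 := integrable_smul_of_tsupport_subset hw.2.1 hφ.continuous hc hs
      have h3 : ∀ f : EuclideanSpace ℝ (Fin d) → ℝ, ∫ x, φ x • f x = ∫ x in U, f x * φ x := by
        intro f
        rw [setIntegral_eq_integral_of_forall_compl_eq_zero fun x hx => by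
          rw [image_eq_zero_of_notMem_tsupport fun h' => hx (hs h'), mul_zero]]
        exact integral_congr_ae (ae_of_all _ fun x => mul_comm _ _)
      simp only [Pi.sub_apply, smul_sub]
      rw [integral_sub h1 h2, h3, h3]
      linarith [hg.2.2 φ hφ hc hs, hw.2.2 φ hφ hc hs]
  rw [EventuallyEq, ae_restrict_iff' hU.measurableSet]
  exact h.mono fun x hx hxU => sub_eq_zero.1 (hx hxU)

theorem pderiv_mem_restrictTotalDegree {σ : Type*} {r : ℕ} {i : σ} {p : MvPolynomial σ ℝ}
    (hp : p ∈ MvPolynomial.restrictTotalDegree σ ℝ (r + 1)) :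
    MvPolynomial.pderiv i p ∈ MvPolynomial.restrictTotalDegree σ ℝ r := by
  rw [MvPolynomial.mem_restrictTotalDegree] at hp
  rw [p.as_sum, map_sum]
  refine Submodule.sum_mem _ fun m hm => ?_
  rw [MvPolynomial.pderiv_monomial]
  by_cases h : m i = 0
  · simp [h]
  · rw [MvPolynomial.mem_restrictTotalDegree]
    refine (MvPolynomial.totalDegree_monomial_le _ _).trans ?_
    have h1 : m.sum (fun _ => id) ≤ r + 1 := (MvPolynomial.le_totalDegree hm).trans hp
    have h2 : (m - Finsupp.single i 1) + Finsupp.single i 1 = m :=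
      Finsupp.sub_add_single_one_cancel h
    rw [← h2, Finsupp.sum_add_index' (by simp) (by simp)] at h1
    simp only [Finsupp.sum_single_index, id] at h1
    exact Nat.le_of_succ_le_succ h1

theorem eq_zero_of_polyEval_eq_zero {d : ℕ} {U : Set (EuclideanSpace ℝ (Fin d))} (hU : IsOpen U)
    (hne : U.Nonempty) {p : MvPolynomial (Fin d) ℝ} (h : ∀ x ∈ U, polyEval p x = 0) : p = 0 := by
  obtain ⟨x, hx⟩ := hne
  have hV : IsOpen ((WithLp.toLp 2 : (Fin d → ℝ) → EuclideanSpace ℝ (Fin d)) ⁻¹' U) :=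
    hU.preimage (PiLp.continuous_toLp 2 _)
  obtain ⟨δ, hδ, hball⟩ := Metric.isOpen_iff.1 hV (WithLp.ofLp x) hx
  rw [ball_pi _ hδ] at hball
  refine MvPolynomial.funext_set (fun j => Metric.ball (WithLp.ofLp x j) δ) (fun j => ?_) ?_
  · rw [Real.ball_eq_Ioo]
    exact Ioo_infinite (by linarith)
  · intro y hy
    rw [map_zero]
    exact h _ (hball hy)

/-- Pythagoras: adding an orthogonal function does not decrease the `L²` norm. -/
theorem eLpNorm_two_le_of_integral_mul_eq_zero {α : Type*} [MeasurableSpace α] {μ : Measure α}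
    {u w : α → ℝ} (hu : MemLp u 2 μ) (hw : MemLp w 2 μ) (h : ∫ x, u x * w x ∂μ = 0) :
    eLpNorm u 2 μ ≤ eLpNorm (fun x => u x + w x) 2 μ := by
  have huw : MemLp (fun x => u x + w x) 2 μ := hu.add hw
  rw [hu.eLpNorm_eq_integral_rpow_norm two_ne_zero ENNReal.ofNat_ne_top,
    huw.eLpNorm_eq_integral_rpow_norm two_ne_zero ENNReal.ofNat_ne_top]
  refine ENNReal.ofReal_le_ofReal (Real.rpow_le_rpow
    (integral_nonneg fun x => by positivity) ?_ (by positivity))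
  simp only [ENNReal.toReal_ofNat, Real.rpow_ofNat, Real.norm_eq_abs, sq_abs]
  have hexp : ∀ x, (u x + w x) ^ 2 = u x ^ 2 + 2 * (u x * w x) + w x ^ 2 := fun x => by ring
  have h1 := hu.integrable_sq
  have h2 : Integrable (fun x => 2 * (u x * w x)) μ := (hu.integrable_mul hw).const_mul 2
  have h3 := hw.integrable_sq
  simp only [hexp]
  have h4 : ∫ x, u x ^ 2 + 2 * (u x * w x) + w x ^ 2 ∂μ
      = (∫ x, u x ^ 2 ∂μ) + 2 * (∫ x, u x * w x ∂μ) + ∫ x, w x ^ 2 ∂μ := by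
    rw [← integral_const_mul, ← integral_add h1 h2]
    exact integral_add (h1.add h2) h3
  rw [h4, h]
  have : 0 ≤ ∫ x, w x ^ 2 ∂μ := integral_nonneg fun x => sq_nonneg _
  linarith

theorem Polytope.memLp_polyEval {d : ℕ} (K : Polytope d) (p : MvPolynomial (Fin d) ℝ) :
    MemLp (polyEval p) 2 (volume.restrict K.carrier) := by
  obtain ⟨C, hC⟩ := K.isCompact_closure.exists_bound_of_continuousOn
    (contDiff_polyEval p).continuous.continuousOn
  have : IsFiniteMeasure (volume.restrict K.carrier) :=
    isFiniteMeasure_restrict.2 K.volume_carrier_lt_top.ne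
  exact MemLp.of_bound (contDiff_polyEval p).continuous.aestronglyMeasurable C
    ((ae_restrict_iff' K.isOpen_carrier.measurableSet).2
      (ae_of_all _ fun x hx => hC x (subset_closure hx)))

namespace Mesh

variable {d N : ℕ} {Ω : Set (EuclideanSpace ℝ (Fin d))} (T : Mesh d Ω N)

theorem integrable_mul_polyEval {g : EuclideanSpace ℝ (Fin d) → ℝ} {k : Fin N}
    (hg : MemLp g 2 (volume.restrict (T.cell k).carrier)) (p : MvPolynomial (Fin d) ℝ) :
    Integrable (fun x => g x * polyEval p x) (volume.restrict (T.cell k).carrier) :=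
  hg.integrable_mul ((T.cell k).memLp_polyEval p)

/-- The `L²(𝒯_h)` pairing of a piecewise square integrable function with the elements of `V_r^h`, as
a linear functional. -/
noncomputable def pairing {r : ℕ} (g : Fin N → EuclideanSpace ℝ (Fin d) → ℝ)
    (hg : ∀ k, MemLp (g k) 2 (volume.restrict (T.cell k).carrier)) :
    Module.Dual ℝ (DGSpace d N r) where
  toFun φ := ∑ k, ∫ x in (T.cell k).carrier, g k x * polyEval (φ k) x
  map_add' φ ψ := by
    rw [← Finset.sum_add_distrib]
    refine Finset.sum_congr rfl fun k _ => ?_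
    rw [← integral_add (T.integrable_mul_polyEval (hg k) _) (T.integrable_mul_polyEval (hg k) _)]
    exact integral_congr_ae (ae_of_all _ fun x => by simp [polyEval, mul_add])
  map_smul' c φ := by
    rw [RingHom.id_apply, smul_eq_mul, Finset.mul_sum]
    refine Finset.sum_congr rfl fun k _ => ?_
    rw [← integral_const_mul]
    exact integral_congr_ae (ae_of_all _ fun x => by simp [polyEval, mul_left_comm])

theorem pairing_polyEval_comm {r : ℕ} (D φ : DGSpace d N r) :
    T.pairing (fun k => polyEval (D k)) (fun k => (T.cell k).memLp_polyEval _) φ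
      = T.pairing (fun k => polyEval (φ k)) (fun k => (T.cell k).memLp_polyEval _) D := by
  change ∑ k : Fin N, _ = ∑ k : Fin N, _
  exact Finset.sum_congr rfl fun k _ => integral_congr_ae (ae_of_all _ fun x => mul_comm _ _)

/-- The mass matrix of `V_r^h`, as a map to the dual space. -/
noncomputable def massMap (r : ℕ) : DGSpace d N r →ₗ[ℝ] Module.Dual ℝ (DGSpace d N r) where
  toFun D := T.pairing (fun k => polyEval (D k)) fun k => (T.cell k).memLp_polyEval _
  map_add' D D' := LinearMap.ext fun φ => by
    rw [LinearMap.add_apply, T.pairing_polyEval_comm (D + D') φ, map_add,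
      T.pairing_polyEval_comm φ D, T.pairing_polyEval_comm φ D']
  map_smul' c D := LinearMap.ext fun φ => by
    rw [LinearMap.smul_apply, T.pairing_polyEval_comm (c • D) φ, map_smul,
      T.pairing_polyEval_comm φ D, RingHom.id_apply]

/-- The mass matrix is positive definite: a polynomial that vanishes almost everywhere on a cell
vanishes on a nonempty open set, hence identically. -/
theorem massMap_injective (r : ℕ) : Function.Injective (T.massMap r) := by
  rw [injective_iff_map_eq_zero]
  intro D hD
  have h0 : ∑ k, ∫ x in (T.cell k).carrier, polyEval (D k) x * polyEval (D k) x = 0 :=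
    LinearMap.congr_fun hD D
  rw [Finset.sum_eq_zero_iff_of_nonneg fun k _ => integral_nonneg fun x => mul_self_nonneg _] at h0
  funext k
  have h1 := h0 k (Finset.mem_univ k)
  rw [integral_eq_zero_iff_of_nonneg (fun x => mul_self_nonneg _)
    (T.integrable_mul_polyEval ((T.cell k).memLp_polyEval _) _)] at h1
  have h2 : polyEval (D k : MvPolynomial (Fin d) ℝ) =ᵐ[volume.restrict (T.cell k).carrier]
      fun _ => 0 := h1.mono fun x hx => mul_self_eq_zero.1 hx
  have h3 := Measure.eqOn_open_of_ae_eq h2 (T.cell k).isOpen_carrier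
    (contDiff_polyEval _).continuous.continuousOn continuousOn_const
  exact Subtype.ext (eq_zero_of_polyEval_eq_zero (T.cell k).isOpen_carrier (T.cell k).nonempty h3)

theorem massMap_surjective (r : ℕ) : Function.Surjective (T.massMap r) :=
  (LinearMap.injective_iff_surjective_of_finrank_eq_finrank
    (Subspace.dual_finrank_eq (K := ℝ) (V := DGSpace d N r)).symm).1 (T.massMap_injective r)

/-- Testing with functions supported in one cell: the `L²(𝒯_h)` projection onto `V_r^h` is, on
every cell, the best approximation of `g` by polynomials of degree at most `r`. -/
theorem cellNorm_sub_le {r : ℕ} {g : EuclideanSpace ℝ (Fin d) → ℝ}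
    (hg : ∀ k, MemLp g 2 (volume.restrict (T.cell k).carrier)) {D : DGSpace d N r}
    (hD : ∀ φ : DGSpace d N r, ∑ k, ∫ x in (T.cell k).carrier, polyEval (D k) x * polyEval (φ k) x
      = ∑ k, ∫ x in (T.cell k).carrier, g x * polyEval (φ k) x)
    (k : Fin N) {p : MvPolynomial (Fin d) ℝ}
    (hp : p ∈ MvPolynomial.restrictTotalDegree (Fin d) ℝ r) :
    T.cellNorm k (fun x => g x - polyEval (D k) x) ≤ T.cellNorm k (fun x => g x - polyEval p x) := by
  let q : MvPolynomial.restrictTotalDegree (Fin d) ℝ r := D k - ⟨p, hp⟩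
  have hq : ∀ x, polyEval (q : MvPolynomial (Fin d) ℝ) x = polyEval (D k) x - polyEval p x :=
    fun x => by simp [q, polyEval]
  have hsingle : ∀ u : Fin N → EuclideanSpace ℝ (Fin d) → ℝ,
      ∑ l, ∫ x in (T.cell l).carrier, u l x *
        polyEval ((Pi.single k q : DGSpace d N r) l) x
      = ∫ x in (T.cell k).carrier, u k x * polyEval (q : MvPolynomial (Fin d) ℝ) x := by
    intro u
    rw [Finset.sum_eq_single k]
    · simp only [Pi.single_eq_same]
    · intro l _ hl
      simp only [Pi.single_eq_of_ne hl]
      simp [polyEval]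
    · simp
  have h1 := hD (Pi.single k q)
  rw [hsingle fun k => polyEval (D k), hsingle fun _ => g] at h1
  have horth : ∫ x in (T.cell k).carrier,
      (g x - polyEval (D k) x) * polyEval (q : MvPolynomial (Fin d) ℝ) x = 0 := by
    simp only [sub_mul]
    rw [integral_sub (T.integrable_mul_polyEval (hg k) _)
      (T.integrable_mul_polyEval ((T.cell k).memLp_polyEval _) _), h1, sub_self]
  have h2 := eLpNorm_two_le_of_integral_mul_eq_zero ((hg k).sub ((T.cell k).memLp_polyEval (D k)))
    ((T.cell k).memLp_polyEval q) horth
  refine h2.trans (le_of_eq ?_)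
  unfold cellNorm
  congr 1
  funext x
  simp only [Pi.sub_apply, hq]
  ring

end Mesh
end DGCalculus

/-! ### Well-posedness and the error bounds -/

theorem mainTheorem7 {d N : ℕ} (Ω : Set (EuclideanSpace ℝ (Fin d)))
    (hΩ : IsOpen Ω) (hΩb : Bornology.IsBounded Ω)
    (T : DGCalculus.Mesh d Ω N) (r : ℕ) (i : Fin d)
    (γ : DGCalculus.Mesh.Side → Fin N → Fin N → ℝ)
    (v g : EuclideanSpace ℝ (Fin d) → ℝ)
    (hv : T.MemV v) (hv1 : DGCalculus.MemW1 Ω 2 v)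
    (hg : DGCalculus.IsWeakPartial Ω i v g) :
    -- the discrete derivatives are well defined by their defining identities
    (∀ s : DGCalculus.Mesh.Side,
      (∃! D : DGCalculus.DGSpace d N r, T.IsDiscretePartial i s (γ s) v D) ∧
        T.IsDiscretePartial i s (γ s) v (T.sidedPartial r i s (γ s) v)) ∧
    -- the bound in the broken norm
    (∀ (star : DGCalculus.Mesh.Star) (ψ : DGCalculus.DGSpace d N (r + 1)),
      T.brokenNorm (fun k x =>
          g x - DGCalculus.polyEval (T.discretePartial r i star γ v k) x)
        ≤ T.brokenNorm (fun k x =>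
          g x - DGCalculus.polyEval (MvPolynomial.pderiv i (ψ k : MvPolynomial (Fin d) ℝ)) x)) ∧
    -- the bound on each cell
    (∀ (star : DGCalculus.Mesh.Star) (k : Fin N)
        (ψ : MvPolynomial.restrictTotalDegree (Fin d) ℝ (r + 1)),
      T.cellNorm k (fun x =>
          g x - DGCalculus.polyEval (T.discretePartial r i star γ v k) x)
        ≤ T.cellNorm k (fun x =>
          g x - DGCalculus.polyEval (MvPolynomial.pderiv i (ψ : MvPolynomial (Fin d) ℝ)) x)) := by
  -- `g` is square integrable, as it agrees almost everywhere with the derivative given by `H¹(Ω)`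
  have hgL : MemLp g 2 (volume.restrict Ω) := by
    obtain ⟨w, hw, hw2⟩ := hv1.2 i
    exact hw2.ae_eq (hw.ae_eq hΩ hg)
  have hfin : IsFiniteMeasure (volume.restrict Ω) :=
    isFiniteMeasure_restrict.2 hΩb.measure_lt_top.ne
  have hone : (1 : ℝ≥0∞) ≤ 2 := one_le_two
  have hgK : ∀ k, MemLp g 2 (volume.restrict (T.cell k).carrier) := fun k =>
    hgL.mono_measure (Measure.restrict_mono (T.cell_subset k) le_rfl)
  have hfun : ∀ s (φ : DGCalculus.DGSpace d N r), T.derivFunctional i s (γ s) v φ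
      = ∑ k, ∫ x in (T.cell k).carrier, g x * DGCalculus.polyEval (φ k) x := fun s φ =>
    T.derivFunctional_eq hΩ s (γ s) hv.2 hg (hgL.integrable hone)
      (fun m => (hv1.2 m).imp fun w hw => ⟨hw.1, hw.2.integrable hone⟩) φ
  -- the defining identities say that the mass matrix maps `D` to the pairing with `g`
  have hiff : ∀ s (D : DGCalculus.DGSpace d N r), T.IsDiscretePartial i s (γ s) v D ↔
      T.massMap r D = T.pairing (fun _ => g) hgK := by
    intro s D
    rw [LinearMap.ext_iff]
    exact forall_congr' fun φ => by rw [hfun]; rfl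
  obtain ⟨D, hD⟩ := T.massMap_surjective r (T.pairing (fun _ => g) hgK)
  have hex : ∀ s, ∃ D : DGCalculus.DGSpace d N r, T.IsDiscretePartial i s (γ s) v D :=
    fun s => ⟨D, (hiff s D).2 hD⟩
  have hspec : ∀ s, T.IsDiscretePartial i s (γ s) v (T.sidedPartial r i s (γ s) v) := by
    intro s
    rw [DGCalculus.Mesh.sidedPartial, dif_pos (hex s)]
    exact (hex s).choose_spec
  have huniq : ∀ s D', T.IsDiscretePartial i s (γ s) v D' → D' = D := fun s D' h =>
    T.massMap_injective r (((hiff s D').1 h).trans hD.symm)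
  have hstar : ∀ star, T.discretePartial r i star γ v = D := by
    intro star
    cases star
    · exact huniq _ _ (hspec _)
    · exact huniq _ _ (hspec _)
    · rw [DGCalculus.Mesh.discretePartial, huniq _ _ (hspec _), huniq _ _ (hspec _), ← two_smul ℝ D,
        smul_smul]
      norm_num
  have hcell : ∀ (star : DGCalculus.Mesh.Star) (k : Fin N)
      (ψ : MvPolynomial.restrictTotalDegree (Fin d) ℝ (r + 1)),
      T.cellNorm k (fun x => g x - DGCalculus.polyEval (T.discretePartial r i star γ v k) x)
        ≤ T.cellNorm k (fun x =>
          g x - DGCalculus.polyEval (MvPolynomial.pderiv i (ψ : MvPolynomial (Fin d) ℝ)) x) := by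
    intro star k ψ
    rw [hstar]
    exact T.cellNorm_sub_le hgK (LinearMap.congr_fun hD) k
      (DGCalculus.pderiv_mem_restrictTotalDegree ψ.2)
  refine ⟨fun s => ⟨⟨D, (hiff s D).2 hD, huniq s⟩, hspec s⟩, fun star ψ => ?_, hcell⟩
  exact ENNReal.rpow_le_rpow (Finset.sum_le_sum fun k _ => pow_le_pow_left' (hcell star k (ψ k)) 2)
    (by norm_num)
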